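/- Let $G\subset\{0,1\}^{24}$ be the extended binary Golay code spanned modulo 2 by the 12 rows 100000000000011111111111, 010000000000110100011101, 001000000000101000111011, 000100000000110001110110, 000010000000100011101101, 000001000000100111011010, 000000100000101110110100, 000000010000111101101000, 000000001000111011010001, 000000000100110110100011, 000000000010101101000111, 000000000001111010001110. The (unscaled) Leech lattice $\Lambda\subset\mathbf Z^{24}\subset\mathbf R^{24}$ is the set of all $x=(x_1,\dots,x_{24})$ with $x_i=a+2b_i+4c_i+8d_i$ for all $i$, where $a\in\{0,1\}$, $(b_1,\dots,b_{24})\in G$, $c_i\in\{0,1\}$, $d_i\in\mathbf Z$ and $\sum_i c_i\equiv a\pmod 2$. Number the coordinates anew by $y_k=x_{\sigma(k)}$, where $(\sigma(1),\dots,\sigma(24))=(1,5,6,13,3,7,11,14,2,4,10,15,8,16,17,19,9,12,18,20,21,22,23,24)$. (The supports $\sigma\{1,\dots,8\}$, $\sigma\{9,\dots,16\}$, $\sigma\{17,\dots,24\}$ and the unions of any two of $\sigma\{1,..,4\}$, $\sigma\{5,..,8\}$, $\sigma\{9,..,12\}$, $\sigma\{13,..,16\}$ are words of $G$.) Put $\Lambda_{24}=\Lambda$,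 and for $n=23,22,\dots,1$ let the laminated lattice $\Lambda_n$ be the set of the vectors of $\Lambda_{n+1}$ that satisfy the following condition: $n=23$: $y_{24}=y_{23}$; $22$: $y_{23}=y_{22}$; $21$: $y_{22}=0$; $20$: $y_{21}=0$; $19$: $y_{20}=0$; $18$: $y_{19}+y_{18}+y_{17}=0$; $17$: $y_{19}=0$; $16$: $y_{18}=0$; $15$: $y_{16}=0$; $14$: $y_{15}+y_{14}+y_{13}=0$; $13$: $y_{15}=0$; $12$: $y_{14}=0$; $11$: $y_{12}=y_{11}$; $10$: $y_{11}=y_{10}$; $9$: $y_{10}=0$; $8$: $y_9=0$; $7$: $y_8=y_7$; $6$: $y_7=y_6$; $5$: $y_6=0$; $4$: $y_5=0$; $3$: $y_4=0$; $2$: $y_3+y_2+y_1=0$; $1$: $y_3=0$. (In dimensions 11, 12, 13 these are the laminated lattices $\Lambda_n^{\max}$.) Let $M_n$ be the set of the vectors of norm $\sqrt{32}$ in $\Lambda_n$, and let $H_n$ be the set of all subsets of $M_n$ that contain exactly one of $x$ and $-x$ for each $x\in M_n$. **Theorem.** Let $1\le n\le 21$. Then $\Lambda_n$ spans an $n$-dimensional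 space, and $M_n$ can be divided into at most $n+1$ parts, each of diameter below $\sqrt{96}$. Hence every $S\in H_n$ can be divided into at most $n+1$ parts of diameter below $\sqrt{96}$. For $n\ge 2$ each $S\in H_n$ has diameter exactly $\sqrt{96}$ (for $n=1$ it is a single point). Consequently no element of $H_n$ is a counterexample to Borsuk's conjecture in dimension $n$, that is, a bounded set with at least two points in an $n$-dimensional Euclidean space that cannot be divided into $n+1$ parts of smaller diameter. -/

import Mathlib

/-- The generator matrix of the extended binary Golay code. -/
def golayMatrix : Matrix (Fin 12) (Fin 24) (ZMod 2) :=
  !![1,0,0,0,0,0,0,0,0,0,0,0,0,1,1,1,1,1,1,1,1,1,1,1;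
     0,1,0,0,0,0,0,0,0,0,0,0,1,1,0,1,0,0,0,1,1,1,0,1;
     0,0,1,0,0,0,0,0,0,0,0,0,1,0,1,0,0,0,1,1,1,0,1,1;
     0,0,0,1,0,0,0,0,0,0,0,0,1,1,0,0,0,1,1,1,0,1,1,0;
     0,0,0,0,1,0,0,0,0,0,0,0,1,0,0,0,1,1,1,0,1,1,0,1;
     0,0,0,0,0,1,0,0,0,0,0,0,1,0,0,1,1,1,0,1,1,0,1,0;
     0,0,0,0,0,0,1,0,0,0,0,0,1,0,1,1,1,0,1,1,0,1,0,0;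
     0,0,0,0,0,0,0,1,0,0,0,0,1,1,1,1,0,1,1,0,1,0,0,0;
     0,0,0,0,0,0,0,0,1,0,0,0,1,1,1,0,1,1,0,1,0,0,0,1;
     0,0,0,0,0,0,0,0,0,1,0,0,1,1,0,1,1,0,1,0,0,0,1,1;
     0,0,0,0,0,0,0,0,0,0,1,0,1,0,1,1,0,1,0,0,0,1,1,1;
     0,0,0,0,0,0,0,0,0,0,0,1,1,1,1,0,1,0,0,0,1,1,1,0]

/-- The extended binary Golay code: the 4096 combinations modulo 2 of the rows of the matrix. -/
def golayCode : Submodule (ZMod 2) (Fin 24 → ZMod 2) :=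
  Submodule.span (ZMod 2) (Set.range golayMatrix.row)

/-- The (unscaled) Leech lattice: the integer vectors with `x i = a + 2 b i + 4 c i + 8 d i`, where
`a` and the `c i` are 0 or 1, `b` is a word of the Golay code, and `∑ c i ≡ a (mod 2)`. -/
def leechLattice : Set (Fin 24 → ℤ) :=
  {x | ∃ a : ℤ, (a = 0 ∨ a = 1) ∧ ∃ b ∈ golayCode, ∃ c d : Fin 24 → ℤ,
    (∀ i, c i = 0 ∨ c i = 1) ∧ (∑ i, c i) ≡ a [ZMOD 2] ∧
    ∀ i, x i = a + 2 * ((b i).val : ℤ) + 4 * c i + 8 * d i}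

/-- The order in which the 24 coordinates (numbered from 1 in this list) are run through in the
definition of the laminated sublattices. The places 1-8, 9-16 and 17-24 of the list hold words of
weight 8 of the Golay code, and so do any two of the blocks 1-4, 5-8, 9-12, 13-16. -/
def coordOrder : List ℕ :=
  [1, 5, 6, 13, 3, 7, 11, 14, 2, 4, 10, 15, 8, 16, 17, 19, 9, 12, 18, 20, 21, 22, 23, 24]

/-- The `k`-th coordinate of `x`, for `k` from 1 to 24, in the order of `coordOrder`. -/
def coord (x : Fin 24 → ℤ) (k : ℕ) : ℤ :=
  x (Fin.ofNat 24 (coordOrder.getD (k - 1) 1 - 1))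

/-- The linear condition that cuts the laminated lattice of dimension `n` out of that of dimension
`n + 1`. -/
def addedCondition (x : Fin 24 → ℤ) : ℕ → Prop
  | 23 => coord x 24 = coord x 23
  | 22 => coord x 23 = coord x 22
  | 21 => coord x 22 = 0
  | 20 => coord x 21 = 0
  | 19 => coord x 20 = 0
  | 18 => coord x 19 + coord x 18 + coord x 17 = 0
  | 17 => coord x 19 = 0
  | 16 => coord x 18 = 0
  | 15 => coord x 16 = 0
  | 14 => coord x 15 + coord x 14 + coord x 13 = 0
  | 13 => coord x 15 = 0
  | 12 => coord x 14 = 0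
  | 11 => coord x 12 = coord x 11
  | 10 => coord x 11 = coord x 10
  | 9 => coord x 10 = 0
  | 8 => coord x 9 = 0
  | 7 => coord x 8 = coord x 7
  | 6 => coord x 7 = coord x 6
  | 5 => coord x 6 = 0
  | 4 => coord x 5 = 0
  | 3 => coord x 4 = 0
  | 2 => coord x 3 + coord x 2 + coord x 1 = 0
  | 1 => coord x 3 = 0
  | _ => True

/-- An integer vector as a point of 24-dimensional Euclidean space. -/
noncomputable def toEuclidean24 (x : Fin 24 → ℤ) : EuclideanSpace ℝ (Fin 24) :=
  WithLp.toLp 2 fun i => (x i : ℝ)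

/-- The laminated sublattice `Λ_n` of the Leech lattice, `1 ≤ n ≤ 24` (in the dimensions 11, 12, 13
the one with the most minimal vectors): the vectors of the Leech lattice that satisfy the conditions
added at the dimensions `23, 22, …, n`. -/
def laminatedLattice (n : ℕ) : Set (EuclideanSpace ℝ (Fin 24)) :=
  toEuclidean24 '' {x | x ∈ leechLattice ∧ ∀ m, n ≤ m → m ≤ 23 → addedCondition x m}

/-- `M_n`: the vectors of norm `√32` of `Λ_n`. -/
def minimalVectors (n : ℕ) : Set (EuclideanSpace ℝ (Fin 24)) :=
  {v | v ∈ laminatedLattice n ∧ ‖v‖ = √32}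

/-- `H_n`: the subsets of `M_n` that contain exactly one of `v`, `-v` for each `v` in `M_n`. -/
def halfSystems (n : ℕ) : Set (Set (EuclideanSpace ℝ (Fin 24))) :=
  {S | S ⊆ minimalVectors n ∧ ∀ v ∈ minimalVectors n, Xor (v ∈ S) (-v ∈ S)}

/-- `S` can be divided into at most `k` parts (some of the `P i` may be empty), each of diameter
below `d`. -/
def DivisibleInto {m : ℕ} (S : Set (EuclideanSpace ℝ (Fin m))) (k : ℕ) (d : ℝ) : Prop :=
  ∃ P : Fin k → Set (EuclideanSpace ℝ (Fin m)),
    (⋃ i, P i) = S ∧ (∀ i j, i ≠ j → Disjoint (P i) (P j)) ∧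
    ∀ i, Bornology.IsBounded (P i) ∧ Metric.diam (P i) < d

/-- `S` is a counterexample to Borsuk's conjecture in dimension `n`: a bounded set with at least two
points, lying in an `n`-dimensional Euclidean space (here an affine subspace of dimension at most `n`
of some `ℝ^m`), that cannot be divided into `n + 1` parts of smaller diameter. -/
def IsBorsukCounterexample {m : ℕ} (n : ℕ) (S : Set (EuclideanSpace ℝ (Fin m))) : Prop :=
  Bornology.IsBounded S ∧ S.Nontrivial ∧ Module.finrank ℝ (vectorSpan ℝ S) ≤ n ∧
    ¬ DivisibleInto S (n + 1) (Metric.diam S)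

/-!
Because of the condition `y₂₂ = 0` the minimal vectors in dimension `n ≤ 21` have even entries. They
are the vectors `2 t` for which `t` has either two entries `±2`, or the entries `±1` on an octad of
the Golay code with an even number of minus signs. The distance of `2 t` and `2 u` is below `√96`
exactly if the scalar product of `t` and `u` exceeds `-4`, so `n + 1` classes without pairs of
scalar product `≤ -4` are wanted.

Two vectors that both have their largest entry, with a plus sign, at a place `c` have scalar product
at least `-2` unless they belong to the same octad, for two octads meet in at most four places. This
gives a class for every place `0 < c < n`, provided that the sign patterns on one octad are so
distributed among its places with a plus sign that patterns in the same class differ in at most four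
places. What escapes are vectors with few plus signs, and these fill the classes `0` and `n`.

In a set without antipodal points `t + u ≠ 0`, so `t + u` has squared length at least `8`, and all
distances are at most `√96`. Three minimal vectors with sum `0` have mutual distances `√96`, and two
of the three, or their negatives, lie in any set that contains one of `x`, `-x` for each `x`.
-/

open Finset
open scoped symmDiff

theorem card_symmDiff_add {α : Type*} [DecidableEq α] (P Q : Finset α) :
    #(P ∆ Q) + 2 * #(P ∩ Q) = #P + #Q := by
  have hPQ := card_sdiff_add_card_inter P Q
  have hQP := card_sdiff_add_card_inter Q P
  have hunion : #(P ∆ Q) = #(P \ Q) + #(Q \ P) :=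
    card_union_of_disjoint disjoint_sdiff_sdiff
  rw [inter_comm] at hQP
  omega

theorem even_card_symmDiff {α : Type*} [DecidableEq α] {P Q : Finset α} (hP : Even #P)
    (hQ : Even #Q) : Even #(P ∆ Q) := by
  have := card_symmDiff_add P Q
  grind

/-- A template for the signs of a vector on an octad, whose places are numbered in increasing order:
it asks for `+` at the watched places in `plus` and for `-` at the other watched places. -/
structure SignTemplate where
  plus : Finset (Fin 8)
  watched : Finset (Fin 8)

namespace SignTemplate

/-- The pattern with `+` at `P` fits the template if at most `(#T.watched - 3) / 2` of the watched
signs are wrong, so that two fitting patterns agree at three or more watched places. -/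
def Fits (T : SignTemplate) (P : Finset (Fin 8)) : Prop :=
  2 * #((P ∆ T.plus) ∩ T.watched) + 3 ≤ #T.watched

instance (T : SignTemplate) (P : Finset (Fin 8)) : Decidable (T.Fits P) :=
  inferInstanceAs (Decidable (_ ≤ _))

theorem Fits.card_symmDiff_le_five {T : SignTemplate} {P Q : Finset (Fin 8)} (hP : T.Fits P)
    (hQ : T.Fits Q) : #(P ∆ Q) ≤ 5 := by
  have hsub : P ∆ Q ⊆ (P ∆ T.plus) ∩ T.watched ∪ (Q ∆ T.plus) ∩ T.watched ∪ T.watchedᶜ := by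
    intro i
    simp only [mem_union, mem_inter, mem_symmDiff, mem_compl]
    tauto
  have hcard := (card_le_card hsub).trans (card_union_le _ _)
  have hunion := card_union_le ((P ∆ T.plus) ∩ T.watched) ((Q ∆ T.plus) ∩ T.watched)
  have hcompl := card_compl_add_card T.watched
  rw [Fintype.card_fin] at hcompl
  unfold Fits at hP hQ
  omega

end SignTemplate

section SignPatterns

/-- The templates of the classes into which the sign patterns on an octad are sorted, found by
computer search. The flag `z` tells whether the octad contains the first place of all, the flag `o`
whether the last two signs are opposite; the class with index `g` belongs to the `g`-th place of the
octad. An empty set of watched places stands for a missing template: nothing fits it. -/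
def signTemplate : Bool → Bool → Fin 8 → SignTemplate
  | false, false =>
    ![⟨{0, 1, 3, 4, 5}, {7}ᶜ⟩, ⟨{1, 5}, {7}ᶜ⟩, ⟨{0, 1, 2, 5}, {7}ᶜ⟩, ⟨{2, 3, 5, 6}, {7}ᶜ⟩,
      ⟨{2, 3, 4, 6}, {7}ᶜ⟩, ⟨{4, 5, 6}, {7}ᶜ⟩, ⟨∅, ∅⟩, ⟨{2, 3, 4}, {7}ᶜ⟩]
  | true, false =>
    ![⟨∅, ∅⟩, ⟨{0, 1, 4, 5, 6}, {7}ᶜ⟩, ⟨{1, 2, 4}, {1, 2, 4, 6, 7}⟩, ⟨{1, 3}, {7}ᶜ⟩,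
      ⟨{4}, {1, 2, 4}⟩, ⟨{2, 5, 6}, {1, 2, 4, 5, 6}⟩, ⟨∅, ∅⟩, ⟨{2, 7}, {1, 2, 4, 6, 7}⟩]
  | false, true =>
    ![⟨{0, 1, 5, 6}, {7}ᶜ⟩, ⟨{1, 6}, {7}ᶜ⟩, ⟨{0, 2, 4}, {7}ᶜ⟩, ⟨{1, 2, 3}, {7}ᶜ⟩,
      ⟨{0, 1, 4}, {7}ᶜ⟩, ⟨{5}, {7}ᶜ⟩, ⟨∅, ∅⟩, ⟨∅, ∅⟩]
  | true, true =>
    ![⟨∅, ∅⟩, ⟨{0, 1, 5, 6}, {7}ᶜ⟩, ⟨{1, 2, 5}, {7}ᶜ⟩, ⟨{1, 2, 3}, {7}ᶜ⟩, ⟨{0, 4, 5}, {7}ᶜ⟩,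
      ⟨{0, 5}, {7}ᶜ⟩, ⟨∅, ∅⟩, ⟨∅, ∅⟩]

/-- The sign patterns, given by the set `P` of plus signs, that are sorted into the classes of the
places of the octad. The others that occur have at most two plus signs; the classes `firstClass` and
`lastClass` take them. -/
def IsOrdinaryPattern (z o : Bool) (P : Finset (Fin 8)) : Prop :=
  Even #P ∧ P ≠ ∅ ∧ (o → (6 ∈ P ↔ 7 ∉ P)) ∧
    (#P = 2 → (z → 0 ∉ P) ∧ ((if z then 1 else 0) ∈ P → o ∧ 7 ∉ P))

instance (z o : Bool) (P : Finset (Fin 8)) : Decidable (IsOrdinaryPattern z o P) :=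
  inferInstanceAs (Decidable (_ ∧ _))

/-- The plus signs of a pattern at places that own a class. The first place of all and the places
from the dimension of the lattice on own none; on the latter a vector without opposite tail repeats
the sign before. -/
def usableIndices (z o : Bool) (P : Finset (Fin 8)) : Finset (Fin 8) :=
  P.filter fun g => (z → g ≠ 0) ∧
    if o then g ≠ 7 else (6 ∈ P ↔ 7 ∈ P) → g ≠ 7 ∧ ((5 ∈ P ↔ 6 ∈ P) → g ≠ 6)

/-- The ordinary patterns that fit the template of none of their usable places. -/
def leftoverPatterns (z o : Bool) : Finset (Finset (Fin 8)) :=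
  {P | IsOrdinaryPattern z o P ∧ ∀ g ∈ usableIndices z o P, ¬(signTemplate z o g).Fits P}

/-- The class of patterns owned by the `g`-th place of an octad. The leftover patterns go to place
`6`, which has no template. -/
def patternClass (z o : Bool) (g : Fin 8) : Set (Finset (Fin 8)) :=
  {P | Even #P ∧ g ∈ usableIndices z o P ∧
    ((signTemplate z o g).Fits P ∨ g = 6 ∧ P ∈ leftoverPatterns z o)}

theorem six_mem_usableIndices_of_mem_leftoverPatterns :
    ∀ z o, ∀ P ∈ leftoverPatterns z o, 6 ∈ usableIndices z o P := by
  decide +kernel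

theorem card_symmDiff_le_four_of_mem_leftoverPatterns :
    ∀ z o, ∀ P ∈ leftoverPatterns z o, ∀ Q ∈ leftoverPatterns z o, #(P ∆ Q) ≤ 4 := by
  decide +kernel

theorem not_fits_signTemplate_six (z o : Bool) (P : Finset (Fin 8)) :
    ¬(signTemplate z o 6).Fits P := by
  cases z <;> cases o <;> simp [SignTemplate.Fits, signTemplate]

variable {z o : Bool} {g : Fin 8} {P Q : Finset (Fin 8)}

theorem IsOrdinaryPattern.exists_mem_patternClass (hP : IsOrdinaryPattern z o P) :
    ∃ g, P ∈ patternClass z o g := by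
  by_cases hfit : ∃ g ∈ usableIndices z o P, (signTemplate z o g).Fits P
  · obtain ⟨g, hg, hgP⟩ := hfit
    exact ⟨g, hP.1, hg, .inl hgP⟩
  · have hleft : P ∈ leftoverPatterns z o := by
      simpa only [leftoverPatterns, mem_filter_univ, hP, true_and, not_exists, not_and] using hfit
    exact ⟨6, hP.1, six_mem_usableIndices_of_mem_leftoverPatterns z o P hleft, .inr ⟨rfl, hleft⟩⟩

theorem card_symmDiff_le_four_of_mem_patternClass (hP : P ∈ patternClass z o g)
    (hQ : Q ∈ patternClass z o g) : #(P ∆ Q) ≤ 4 := by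
  obtain ⟨hPeven, -, hPfit | ⟨rfl, hPleft⟩⟩ := hP
  · obtain ⟨hQeven, -, hQfit | ⟨rfl, -⟩⟩ := hQ
    · have hle := hPfit.card_symmDiff_le_five hQfit
      obtain ⟨k, hk⟩ := even_card_symmDiff hPeven hQeven
      omega
    · exact absurd hPfit (not_fits_signTemplate_six z o P)
  · obtain ⟨-, -, hQfit | ⟨-, hQleft⟩⟩ := hQ
    · exact absurd hQfit (not_fits_signTemplate_six z o Q)
    · exact card_symmDiff_le_four_of_mem_leftoverPatterns z o P hPleft Q hQleft

end SignPatterns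

section SignVector

variable {ι : Type*} [DecidableEq ι] {O O' P P' : Finset ι} {i : ι}

/-- The vector that is `1` at the places of `O` in `P`, `-1` at the other places of `O` and `0`
outside `O`. -/
def signVector (O P : Finset ι) : ι → ℤ := fun i => if i ∈ O then if i ∈ P then 1 else -1 else 0

theorem signVector_ne_zero_iff : signVector O P i ≠ 0 ↔ i ∈ O := by
  unfold signVector; split_ifs <;> simp [*]

theorem signVector_eq_one_iff : signVector O P i = 1 ↔ i ∈ O ∧ i ∈ P := by
  unfold signVector; split_ifs <;> simp [*]

theorem abs_signVector_le_one (O P : Finset ι) (i : ι) : |signVector O P i| ≤ 1 := by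
  unfold signVector; split_ifs <;> simp

variable [Fintype ι]

theorem signVector_dotProduct (O P O' P' : Finset ι) :
    signVector O P ⬝ᵥ signVector O' P' = #(O ∩ O') - 2 * #(O ∩ O' ∩ (P ∆ P')) := by
  have hterm : ∀ i, signVector O P i * signVector O' P' i =
      (if i ∈ O ∩ O' then 1 else 0) - 2 * if i ∈ O ∩ O' ∩ (P ∆ P') then 1 else 0 := by
    intro i
    simp only [signVector, mem_inter, mem_symmDiff]
    by_cases hO : i ∈ O <;> by_cases hO' : i ∈ O' <;> by_cases hP : i ∈ P <;>
      by_cases hP' : i ∈ P' <;> simp [*]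
  simp only [dotProduct, hterm, sum_sub_distrib, ← mul_sum, sum_boole, filter_mem_eq_inter,
    univ_inter]

theorem neg_two_le_signVector_dotProduct (hOO' : #(O ∩ O') ≤ 4) (hi : signVector O P i = 1)
    (hi' : signVector O' P' i = 1) : -2 ≤ signVector O P ⬝ᵥ signVector O' P' := by
  rw [signVector_eq_one_iff] at hi hi'
  have hlt : #(O ∩ O' ∩ (P ∆ P')) < #(O ∩ O') := by
    refine card_lt_card ⟨inter_subset_left, fun h => ?_⟩
    have := h (mem_inter.2 ⟨hi.1, hi'.1⟩)
    simp only [mem_inter, mem_symmDiff] at this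
    tauto
  rw [signVector_dotProduct]
  omega

theorem signVector_opposite_of_dotProduct_le (hOO' : #(O ∩ O') ≤ 4) (hP : #P ≤ 2)
    (hP' : #P' ≤ 2) (hdot : signVector O P ⬝ᵥ signVector O' P' ≤ -4) :
    #P = 2 ∧ ∀ i, signVector O P i = 1 → signVector O' P' i = -1 := by
  rw [signVector_dotProduct] at hdot
  have hadd := card_symmDiff_add P P'
  have hle : #(O ∩ O' ∩ (P ∆ P')) ≤ #(O ∩ O') := card_le_card inter_subset_left
  have hle' : #(O ∩ O' ∩ (P ∆ P')) ≤ #(P ∆ P') := card_le_card inter_subset_right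
  have hdisj : P ∩ P' = ∅ := card_eq_zero.1 (by omega)
  have hsymm : O ∩ O' ∩ (P ∆ P') = P ∆ P' := eq_of_subset_of_card_le inter_subset_right (by omega)
  refine ⟨by omega, fun i hi => ?_⟩
  have hiP : i ∈ P := (signVector_eq_one_iff.1 hi).2
  have hiP' : i ∉ P' := fun h => notMem_empty i (hdisj ▸ mem_inter.2 ⟨hiP, h⟩)
  have hiO' : i ∈ O' :=
    (mem_inter.1 (inter_eq_right.1 hsymm (mem_symmDiff.2 (.inl ⟨hiP, hiP'⟩)))).2
  simp [signVector, hiO', hiP']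

end SignVector

section PairVector

variable {ι : Type*} [DecidableEq ι]

/-- The vectors with two entries `±2` and zeros elsewhere. -/
def IsPairVector (t : ι → ℤ) : Prop :=
  ∃ i j, i ≠ j ∧ ∃ a b, (a = 2 ∨ a = -2) ∧ (b = 2 ∨ b = -2) ∧ t = Pi.single i a + Pi.single j b

namespace IsPairVector

variable {t u : ι → ℤ} {c : ι}

theorem apply_eq (ht : IsPairVector t) (i : ι) : t i = 0 ∨ t i = 2 ∨ t i = -2 := by
  obtain ⟨j, k, hjk, a, b, ha, hb, rfl⟩ := ht
  by_cases hj : i = j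
  · subst hj; simp [hjk, ha]
  · by_cases hk : i = k
    · subst hk; simp [hj, hb]
    · simp [hj, hk]

theorem exists_ne (ht : IsPairVector t) (c : ι) : ∃ i, i ≠ c ∧ t i ≠ 0 := by
  obtain ⟨i, j, hij, a, b, ha, hb, rfl⟩ := ht
  rcases eq_or_ne i c with rfl | hi
  · exact ⟨j, hij.symm, by rcases hb with rfl | rfl <;> simp [hij.symm]⟩
  · exact ⟨i, hi, by rcases ha with rfl | rfl <;> simp [hij]⟩

theorem exists_eq_single_add_single (ht : IsPairVector t) (hc : t c ≠ 0) :
    ∃ j, j ≠ c ∧ ∃ b, (b = 2 ∨ b = -2) ∧ t = Pi.single c (t c) + Pi.single j b := by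
  obtain ⟨i, j, hij, a, b, ha, hb, rfl⟩ := ht
  rcases eq_or_ne c i with rfl | hi
  · exact ⟨j, hij.symm, b, hb, by simp [hij]⟩
  · rcases eq_or_ne c j with rfl | hj
    · exact ⟨i, hij, a, ha, by simp [hij.symm, add_comm]⟩
    · simp [hi, hj] at hc

theorem eq_or_eq_of_ne_zero (ht : IsPairVector t) {i j k : ι}
    (hi : t i ≠ 0) (hj : t j ≠ 0) (hk : t k ≠ 0) (hij : i ≠ j) : k = i ∨ k = j := by
  obtain ⟨m, -, b, -, heq⟩ := ht.exists_eq_single_add_single hi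
  have hsupp : ∀ l, t l ≠ 0 → l = i ∨ l = m := fun l hl => by
    contrapose! hl
    rw [heq]
    simp [hl.1, hl.2]
  obtain rfl := (hsupp j hj).resolve_left hij.symm
  exact hsupp k hk

variable [Fintype ι]

theorem dotProduct_nonneg (ht : IsPairVector t) (hc : t c = 2) (hu : ∀ i, |u i| ≤ u c) :
    0 ≤ t ⬝ᵥ u := by
  obtain ⟨j, -, b, hb, heq⟩ := ht.exists_eq_single_add_single (c := c) (by omega)
  rw [heq, hc, add_dotProduct, single_dotProduct, single_dotProduct]
  have := abs_le.1 (hu j)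
  rcases hb with rfl | rfl <;> linarith

theorem eq_neg_two_mul_of_dotProduct_le (ht : IsPairVector t) (hu : ∀ i, |u i| ≤ 1)
    (hdot : t ⬝ᵥ u ≤ -4) (hc : t c ≠ 0) : t c = -2 * u c := by
  obtain ⟨j, -, b, hb, heq⟩ := ht.exists_eq_single_add_single hc
  rw [heq, add_dotProduct, single_dotProduct, single_dotProduct] at hdot
  have huj := abs_le.1 (hu j)
  have huc := abs_le.1 (hu c)
  rcases hb with rfl | rfl <;> rcases (ht.apply_eq c).resolve_left hc with h | h <;>
    rw [h] at hdot ⊢ <;> omega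

end IsPairVector

end PairVector

section GolayCode

/-- The word of length 24 whose letters are the binary digits of `m`. -/
def wordOfNat (m : ℕ) : Fin 24 → ZMod 2 := fun i => if m.testBit i then 1 else 0

/-- The sums modulo 2 of the sublists of a list of binary words. -/
def xorSums : List ℕ → List ℕ
  | [] => [0]
  | r :: rs => xorSums rs ++ (xorSums rs).map (r ^^^ ·)

/-- The rows of the generator matrix of the Golay code, the first letter as the lowest digit. -/
def golayRows : List ℕ :=
  [0xffe001, 0xb8b002, 0xdc5004, 0x6e3008, 0xb71010, 0x5b9020, 0x2dd040, 0x16f080, 0x8b7100,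
    0xc5b200, 0xe2d400, 0x717800]

theorem hammingNorm_wordOfNat (m : ℕ) :
    hammingNorm (wordOfNat m) = #{i : Fin 24 | m.testBit i} := by
  simp [hammingNorm, wordOfNat]

theorem wordOfNat_zero : wordOfNat 0 = 0 := by
  funext i
  simp [wordOfNat]

theorem wordOfNat_xor (m k : ℕ) : wordOfNat (m ^^^ k) = wordOfNat m + wordOfNat k := by
  funext i
  simp only [wordOfNat, Pi.add_apply, Nat.testBit_xor]
  cases m.testBit i <;> cases k.testBit i <;> decide

theorem exists_mem_xorSums_of_mem_span {rs : List ℕ} {b : Fin 24 → ZMod 2}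
    (hb : b ∈ Submodule.span (ZMod 2) (wordOfNat '' {r | r ∈ rs})) :
    ∃ m ∈ xorSums rs, wordOfNat m = b := by
  induction rs generalizing b with
  | nil => exact ⟨0, by simp [xorSums], by simp_all [wordOfNat_zero]⟩
  | cons r rs ih =>
    have hset : {x | x ∈ r :: rs} = insert r {x | x ∈ rs} := Set.ext fun _ => List.mem_cons
    rw [hset, Set.image_insert_eq, Submodule.mem_span_insert] at hb
    obtain ⟨a, z, hz, rfl⟩ := hb
    obtain ⟨m, hm, rfl⟩ := ih hz
    obtain rfl | rfl : a = 0 ∨ a = 1 := by revert a; decide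
    · exact ⟨m, by simp [xorSums, hm], by simp⟩
    · exact ⟨r ^^^ m, by simp [xorSums, hm], by rw [wordOfNat_xor, one_smul]⟩

theorem exists_wordOfNat_eq_golayMatrix_row :
    ∀ i, ∃ r ∈ golayRows, wordOfNat r = golayMatrix.row i := by
  decide +kernel

theorem card_testBit_of_mem_xorSums_golayRows : ∀ m ∈ xorSums golayRows,
    m ≠ 0 → 4 ∣ #{i : Fin 24 | m.testBit i} ∧ 8 ≤ #{i : Fin 24 | m.testBit i} := by
  have hall : ((xorSums golayRows).all fun m => decide
      (m ≠ 0 → 4 ∣ #{i : Fin 24 | m.testBit i} ∧ 8 ≤ #{i : Fin 24 | m.testBit i})) = true := by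
    decide +kernel
  simpa only [List.all_eq_true, decide_eq_true_eq] using hall

theorem hammingNorm_of_mem_golayCode {b : Fin 24 → ZMod 2} (hb : b ∈ golayCode) (hb0 : b ≠ 0) :
    4 ∣ hammingNorm b ∧ 8 ≤ hammingNorm b := by
  have hrows : Set.range golayMatrix.row ⊆ wordOfNat '' {r | r ∈ golayRows} :=
    Set.range_subset_iff.2 exists_wordOfNat_eq_golayMatrix_row
  obtain ⟨m, hm, rfl⟩ := exists_mem_xorSums_of_mem_span (Submodule.span_mono hrows hb)
  rw [hammingNorm_wordOfNat]
  exact card_testBit_of_mem_xorSums_golayRows m hm fun h => hb0 (h ▸ wordOfNat_zero)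

/-- The permutation that takes a place in the order `coordOrder` to the coordinate standing there.
Places, as coordinates, are numbered from 0. -/
noncomputable def placeOrder : Equiv.Perm (Fin 24) :=
  Equiv.ofBijective (fun k => Fin.ofNat 24 (coordOrder.getD k 1 - 1)) (by decide)

/-- The sets of places that carry the nonzero letters of a word of the Golay code. -/
def IsGolaySet (O : Finset (Fin 24)) : Prop :=
  ∃ b ∈ golayCode, ∀ k, k ∈ O ↔ b (placeOrder k) ≠ 0

namespace IsGolaySet

variable {O O' : Finset (Fin 24)}

theorem symmDiff (hO : IsGolaySet O) (hO' : IsGolaySet O') : IsGolaySet (O ∆ O') := by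
  obtain ⟨b, hb, hbO⟩ := hO
  obtain ⟨b', hb', hbO'⟩ := hO'
  refine ⟨b + b', golayCode.add_mem hb hb', fun k => ?_⟩
  have hadd : ∀ a c : ZMod 2, a ≠ 0 ∧ c = 0 ∨ c ≠ 0 ∧ a = 0 ↔ a + c ≠ 0 := by decide
  simp only [mem_symmDiff, hbO, hbO', not_not, hadd, Pi.add_apply]

theorem card (hO : IsGolaySet O) (hne : O ≠ ∅) : 4 ∣ #O ∧ 8 ≤ #O := by
  obtain ⟨b, hb, hbO⟩ := hO
  have hcard : #O = hammingNorm b :=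
    card_equiv placeOrder fun k => by simp only [hbO, mem_filter_univ]
  obtain ⟨k, hk⟩ := nonempty_iff_ne_empty.2 hne
  rw [hcard]
  exact hammingNorm_of_mem_golayCode hb fun h => (hbO k).1 hk (congrFun h _)

theorem card_inter_le_four (hO : IsGolaySet O) (hO' : IsGolaySet O') (hcard : #O = 8)
    (hcard' : #O' = 8) (hne : O ≠ O') : #(O ∩ O') ≤ 4 := by
  have hadd := card_symmDiff_add O O'
  have hge := ((hO.symmDiff hO').card (mt symmDiff_eq_bot.1 hne)).2
  omega

end IsGolaySet

end GolayCode

section OctadVectors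

/-- The octads of the Golay code, given by the increasing enumeration of their places. -/
def IsOctad (e : Fin 8 ↪o Fin 24) : Prop := IsGolaySet (univ.map e.toEmbedding)

/-- The vector with the signs of the pattern `A` on the octad `e` and zeros elsewhere. -/
def octadVector (e : Fin 8 ↪o Fin 24) (A : Finset (Fin 8)) : Fin 24 → ℤ :=
  signVector (univ.map e.toEmbedding) (A.map e.toEmbedding)

variable {e f : Fin 8 ↪o Fin 24} {A B : Finset (Fin 8)} {i : Fin 24} {k : Fin 8}

theorem octadVector_apply : octadVector e A (e k) = if k ∈ A then 1 else -1 := by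
  simp [octadVector, signVector]

theorem octadVector_ne_zero_iff : octadVector e A i ≠ 0 ↔ ∃ k, e k = i := by
  simp [octadVector, signVector_ne_zero_iff]

theorem octadVector_eq_one_iff : octadVector e A i = 1 ↔ ∃ k ∈ A, e k = i := by
  simp only [octadVector, signVector_eq_one_iff, mem_map, mem_univ, true_and,
    RelEmbedding.coe_toEmbedding]
  grind

theorem card_inter_le_four_of_isOctad (he : IsOctad e) (hf : IsOctad f) (hne : e ≠ f) :
    #(univ.map e.toEmbedding ∩ univ.map f.toEmbedding) ≤ 4 := by
  refine IsGolaySet.card_inter_le_four he hf (by simp) (by simp) fun h => hne ?_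
  have hcard : #(univ.map f.toEmbedding) = 8 := by simp
  rw [orderEmbOfFin_unique' hcard (f := f) fun k => mem_map_of_mem _ (mem_univ k)]
  exact orderEmbOfFin_unique' hcard fun k => h ▸ mem_map_of_mem _ (mem_univ k)

theorem octadVector_dotProduct_octadVector (e : Fin 8 ↪o Fin 24) (A B : Finset (Fin 8)) :
    octadVector e A ⬝ᵥ octadVector e B = 8 - 2 * #(A ∆ B) := by
  have hmap : A.map e.toEmbedding ∆ B.map e.toEmbedding = (A ∆ B).map e.toEmbedding := by
    ext i
    simp only [mem_symmDiff, mem_map]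
    grind [e.injective]
  rw [octadVector, octadVector, signVector_dotProduct, hmap, inter_self, ← map_inter,
    univ_inter, card_map, card_map, card_univ, Fintype.card_fin, Nat.cast_ofNat]

theorem sum_octadVector (e : Fin 8 ↪o Fin 24) (A : Finset (Fin 8)) :
    ∑ i, octadVector e A i = 2 * #A - 8 := by
  have hsum : ∑ k, (if k ∈ A then 1 else -1) = ∑ i, octadVector e A i :=
    Fintype.sum_of_injective e e.injective _ _
      (fun i hi => not_not.1 (mt octadVector_ne_zero_iff.1 hi)) fun k => octadVector_apply.symm
  have hcompl := card_compl_add_card A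
  rw [Fintype.card_fin] at hcompl
  rw [← hsum, sum_ite, sum_const, sum_const, filter_mem_eq_inter, univ_inter,
    filter_not, filter_mem_eq_inter, univ_inter, ← compl_eq_univ_sdiff, nsmul_eq_mul, nsmul_eq_mul]
  omega

end OctadVectors

/-- The vectors `t` of places such that `2 t`, with its entries moved from the places to their
coordinates, is a vector with even entries of the Leech lattice. -/
structure IsHalfLeech (t : Fin 24 → ℤ) : Prop where
  isGolaySet : IsGolaySet {i | Odd (t i)}
  four_dvd_sum : 4 ∣ ∑ i, t i

theorem ite_odd_le_sq (a : ℤ) : (if Odd a then 1 else 0) ≤ a ^ 2 := by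
  split_ifs with ha
  · exact Order.one_le_iff_pos.2 (sq_pos_of_ne_zero fun h => by simp [h] at ha)
  · positivity

theorem card_odd_le_sum_sq {ι : Type*} [Fintype ι] (t : ι → ℤ) :
    (#{i | Odd (t i)} : ℤ) ≤ ∑ i, t i ^ 2 := by
  rw [← sum_boole (R := ℤ)]
  exact sum_le_sum fun i _ => ite_odd_le_sq (t i)

theorem even_sum_sq_iff {ι : Type*} [Fintype ι] (w : ι → ℤ) :
    Even (∑ i, w i ^ 2) ↔ Even (∑ i, w i) := by
  have hdiff : Even (∑ i, w i ^ 2 - ∑ i, w i) := by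
    rw [← sum_sub_distrib]
    exact even_sum _ fun i _ => by simp [sq, ← mul_sub_one, Int.even_mul_pred_self]
  exact Int.even_sub.1 hdiff

theorem exists_single_add_single_of_sum_sq_eq_two {ι : Type*} [Fintype ι] [DecidableEq ι]
    {w : ι → ℤ} (hw : ∑ i, w i ^ 2 = 2) :
    ∃ i j, i ≠ j ∧ (w i = 1 ∨ w i = -1) ∧ (w j = 1 ∨ w j = -1) ∧
      w = Pi.single i (w i) + Pi.single j (w j) := by
  have hval : ∀ i, w i = 0 ∨ w i = 1 ∨ w i = -1 := by
    intro i
    have hle : w i ^ 2 ≤ 2 := hw ▸ single_le_sum (fun j _ => sq_nonneg (w j)) (mem_univ i)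
    have hlt : w i < 2 := by nlinarith
    have hgt : -2 < w i := by nlinarith
    omega
  have hcard : (#{i | w i ≠ 0} : ℤ) = 2 := by
    rw [← hw, card_filter]
    push_cast
    refine sum_congr rfl fun i _ => ?_
    rcases hval i with h | h | h <;> simp [h]
  obtain ⟨i, j, hij, hsupp⟩ := card_eq_two.1 (Nat.cast_injective hcard)
  have hmem : ∀ k, w k ≠ 0 ↔ k = i ∨ k = j := fun k => by
    simpa using Finset.ext_iff.1 hsupp k
  refine ⟨i, j, hij, (hval i).resolve_left ((hmem i).2 (.inl rfl)),
    (hval j).resolve_left ((hmem j).2 (.inr rfl)), funext fun k => ?_⟩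
  by_cases hki : k = i
  · subst hki; simp [hij]
  · by_cases hkj : k = j
    · subst hkj; simp [hij.symm]
    · simpa [hki, hkj] using hmem k

namespace IsHalfLeech

variable {t u : Fin 24 → ℤ}

theorem add (ht : IsHalfLeech t) (hu : IsHalfLeech u) : IsHalfLeech (t + u) where
  isGolaySet := by
    convert ht.isGolaySet.symmDiff hu.isGolaySet using 1
    ext i
    simp only [mem_filter_univ, mem_symmDiff, Pi.add_apply, Int.odd_add, ← Int.not_odd_iff_even]
    tauto
  four_dvd_sum := by
    simp only [Pi.add_apply, sum_add_distrib]
    exact dvd_add ht.four_dvd_sum hu.four_dvd_sum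

theorem eight_le_card_odd (ht : IsHalfLeech t) {i : Fin 24} (hi : Odd (t i)) :
    8 ≤ #{i | Odd (t i)} :=
  (ht.isGolaySet.card (ne_empty_of_mem ((mem_filter_univ i).2 hi))).2

theorem exists_two_smul_of_forall_not_odd (ht : IsHalfLeech t) (heven : ∀ i, ¬Odd (t i)) :
    ∃ w : Fin 24 → ℤ, t = 2 • w ∧ Even (∑ i, w i ^ 2) := by
  choose w hw using fun i => even_iff_exists_two_mul.1 (Int.not_odd_iff_even.1 (heven i))
  refine ⟨w, funext fun i => by simp [hw], (even_sum_sq_iff w).2 ?_⟩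
  have hdvd := ht.four_dvd_sum
  simp only [hw, ← mul_sum] at hdvd
  exact even_iff_two_dvd.2 (by omega)

theorem eight_le_sum_sq (ht : IsHalfLeech t) (ht0 : t ≠ 0) : 8 ≤ ∑ i, t i ^ 2 := by
  by_cases hodd : ∃ i, Odd (t i)
  · obtain ⟨i, hi⟩ := hodd
    exact le_trans (by exact_mod_cast ht.eight_le_card_odd hi) (card_odd_le_sum_sq t)
  · obtain ⟨w, rfl, heven⟩ := ht.exists_two_smul_of_forall_not_odd (not_exists.1 hodd)
    obtain ⟨i, hi⟩ := Function.ne_iff.1 (right_ne_zero_of_smul ht0)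
    have hpos : 0 < ∑ i, w i ^ 2 := (sq_pos_of_ne_zero hi).trans_le
      (single_le_sum (f := fun i => w i ^ 2) (fun i _ => sq_nonneg _) (mem_univ i))
    simp only [Pi.smul_apply, nsmul_eq_mul, mul_pow, ← mul_sum]
    obtain ⟨r, hr⟩ := heven
    push_cast
    omega

theorem exists_octadVector_eq (ht : IsHalfLeech t) (hsq : ∑ i, t i ^ 2 = 8) {i : Fin 24}
    (hi : Odd (t i)) : ∃ e A, IsOctad e ∧ Even #A ∧ t = octadVector e A := by
  have hge : (8 : ℤ) ≤ #{i | Odd (t i)} := by exact_mod_cast ht.eight_le_card_odd hi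
  have hle := card_odd_le_sum_sq t
  have hcard : #{i | Odd (t i)} = 8 := by omega
  have hsq_eq : ∀ i, (if Odd (t i) then 1 else 0) = t i ^ 2 := fun i =>
    (sum_eq_sum_iff_of_le fun j _ => ite_odd_le_sq (t j)).1
      (by rw [sum_boole, hcard, hsq, Nat.cast_ofNat]) i (mem_univ i)
  let e : Fin 8 ↪o Fin 24 := orderEmbOfFin _ hcard
  have he : univ.map e.toEmbedding = univ.filter fun i => Odd (t i) :=
    map_orderEmbOfFin_univ _ hcard
  let A : Finset (Fin 8) := {k | t (e k) = 1}
  have heq : t = octadVector e A := by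
    funext i
    have hmem : (∃ k, e k = i) ↔ Odd (t i) := by simpa using Finset.ext_iff.1 he i
    have hi := hsq_eq i
    by_cases hodd : Odd (t i)
    · obtain ⟨k, rfl⟩ := hmem.2 hodd
      rw [if_pos hodd, eq_comm, sq_eq_one_iff] at hi
      rcases hi with hi | hi <;> simp [octadVector_apply, A, hi]
    · rw [if_neg hodd] at hi
      rw [not_not.1 (mt octadVector_ne_zero_iff.1 (mt hmem.1 hodd)), sq_eq_zero_iff.1 hi.symm]
  have hsum := ht.four_dvd_sum
  rw [heq, sum_octadVector] at hsum
  exact ⟨e, A, by rw [IsOctad, he]; exact ht.isGolaySet, even_iff_two_dvd.2 (by omega), heq⟩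

theorem isPairVector_or_exists_octadVector_eq (ht : IsHalfLeech t) (hsq : ∑ i, t i ^ 2 = 8) :
    IsPairVector t ∨ ∃ e A, IsOctad e ∧ Even #A ∧ t = octadVector e A := by
  by_cases hodd : ∃ i, Odd (t i)
  · obtain ⟨i, hi⟩ := hodd
    exact .inr (ht.exists_octadVector_eq hsq hi)
  · obtain ⟨w, rfl, -⟩ := ht.exists_two_smul_of_forall_not_odd (not_exists.1 hodd)
    have hw : ∑ i, w i ^ 2 = 2 := by
      simp only [Pi.smul_apply, nsmul_eq_mul, mul_pow, ← mul_sum] at hsq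
      push_cast at hsq
      omega
    obtain ⟨i, j, hij, hi, hj, heq⟩ := exists_single_add_single_of_sum_sq_eq_two hw
    refine .inl ⟨i, j, hij, 2 * w i, 2 * w j, by omega, by omega, ?_⟩
    conv_lhs => rw [heq]
    simp only [smul_add, ← Pi.single_smul, nsmul_eq_mul, Nat.cast_ofNat]

end IsHalfLeech

theorem sum_val_eq_hammingNorm {ι : Type*} [Fintype ι] (b : ι → ZMod 2) :
    ∑ i, (b i).val = hammingNorm b := by
  have hval : ∀ a : ZMod 2, a.val = if a ≠ 0 then 1 else 0 := by decide
  simp only [hammingNorm, card_filter, hval]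

theorem exists_isHalfLeech_of_mem_leechLattice {x : Fin 24 → ℤ} (hx : x ∈ leechLattice)
    {j : Fin 24} (hj : x j = 0) : ∃ t, IsHalfLeech t ∧ x ∘ placeOrder = 2 • t := by
  obtain ⟨a, ha, b, hb, c, d, -, hsum, hxi⟩ := hx
  obtain rfl : a = 0 := by
    have := hxi j
    omega
  let w : Fin 24 → ℤ := fun i => (b i).val + 2 * c i + 4 * d i
  refine ⟨w ∘ placeOrder, ⟨⟨b, hb, fun k => ?_⟩, ?_⟩, funext fun k => ?_⟩
  · have hval : ∀ a : ZMod 2, Odd a.val ↔ a ≠ 0 := by decide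
    have hodd : Odd (w (placeOrder k)) ↔ Odd (b (placeOrder k)).val := by grind
    simp only [mem_filter_univ, Function.comp_apply, hodd, hval]
  · have hweight : 4 ∣ ∑ i, (b i).val := by
      rw [sum_val_eq_hammingNorm]
      rcases eq_or_ne b 0 with rfl | hb0
      · simp
      · exact (hammingNorm_of_mem_golayCode hb hb0).1
    have hsplit : ∑ i, w i = (∑ i, (b i).val : ℕ) + 2 * ∑ i, c i + 4 * ∑ i, d i := by
      simp only [w, sum_add_distrib, mul_sum, Nat.cast_sum]
    simp only [Function.comp_apply, Equiv.sum_comp placeOrder, hsplit]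
    rw [Int.modEq_zero_iff_dvd] at hsum
    omega
  · simp only [Function.comp_apply, hxi, Pi.smul_apply, nsmul_eq_mul, w]
    push_cast
    ring

section ColourClasses

/-- The pair vectors with the property `p` together with the vectors `octadVector e A` of octads
such that `q e A`. -/
def vectorClass (p : (Fin 24 → ℤ) → Prop) (q : (Fin 8 ↪o Fin 24) → Finset (Fin 8) → Prop) :
    Set (Fin 24 → ℤ) :=
  {t | IsPairVector t ∧ p t ∨ ∃ e A, IsOctad e ∧ q e A ∧ t = octadVector e A}

variable {p : (Fin 24 → ℤ) → Prop} {q : (Fin 8 ↪o Fin 24) → Finset (Fin 8) → Prop}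

theorem neg_four_lt_dotProduct_of_mem_vectorClass
    (hpp : ∀ t u, IsPairVector t → IsPairVector u → p t → p u → -4 < t ⬝ᵥ u)
    (hpq : ∀ t e A, IsPairVector t → p t → q e A → -4 < t ⬝ᵥ octadVector e A)
    (hqq : ∀ e f A B, #(univ.map e.toEmbedding ∩ univ.map f.toEmbedding) ≤ 4 → q e A → q f B →
      -4 < octadVector e A ⬝ᵥ octadVector f B)
    (hsame : ∀ e A B, q e A → q e B → #(A ∆ B) ≤ 4) :
    ∀ t ∈ vectorClass p q, ∀ u ∈ vectorClass p q, -4 < t ⬝ᵥ u := by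
  rintro t (⟨htpair, ht⟩ | ⟨e, A, he, hA, rfl⟩) u (⟨hupair, hu⟩ | ⟨f, B, hf, hB, rfl⟩)
  · exact hpp t u htpair hupair ht hu
  · exact hpq t f B htpair ht hB
  · rw [dotProduct_comm]
    exact hpq u e A hupair hu hA
  · rcases eq_or_ne e f with rfl | hne
    · have := hsame e A B hA hB
      rw [octadVector_dotProduct_octadVector]
      omega
    · exact hqq e f A B (card_inter_le_four_of_isOctad he hf hne) hA hB

theorem neg_four_lt_dotProduct_of_forall_mul_nonneg {t u : Fin 24 → ℤ}
    (h : ∀ i, 0 ≤ t i * u i) : -4 < t ⬝ᵥ u :=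
  lt_of_lt_of_le (by norm_num) (sum_nonneg fun i _ => h i)

theorem octadVector_opposite_of_dotProduct_le {e f : Fin 8 ↪o Fin 24} {A B : Finset (Fin 8)}
    (hef : #(univ.map e.toEmbedding ∩ univ.map f.toEmbedding) ≤ 4) (hA : #A ≤ 2) (hB : #B ≤ 2)
    (hdot : octadVector e A ⬝ᵥ octadVector f B ≤ -4) :
    #A = 2 ∧ ∀ i, octadVector e A i = 1 → octadVector f B i = -1 := by
  have h := signVector_opposite_of_dotProduct_le hef (by rwa [card_map]) (by rwa [card_map]) hdot
  rwa [card_map] at h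

/-- The class whose vectors have no positive entry at the places after the first, apart from octad
vectors with two plus signs, the first place being one of them. -/
def firstClass : Set (Fin 24 → ℤ) :=
  vectorClass (fun t => 0 ≤ t 0 ∧ ∀ i ≠ 0, t i ≤ 0)
    fun e A => A = ∅ ∨ #A = 2 ∧ octadVector e A 0 = 1

/-- The class of the place `d`. A pair vector of it may have a positive entry only at `d`, and this
only if `o`. An octad vector of it has two plus signs, one of them at the first place of the octad
after the first place of all, so that no two of these are opposite on four common places. -/
def lastClass (o : Bool) (d : Fin 24) : Set (Fin 24 → ℤ) :=
  vectorClass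
    (fun t => (∀ i, if o ∧ i = d then 0 ≤ t i else t i ≤ 0) ∧ (t 0 < 0 ∨ o ∧ 0 < t d))
    fun e A => #A = 2 ∧ octadVector e A 0 ≠ 1 ∧ (o → octadVector e A d ≠ -1) ∧
      ∃ m > 0, octadVector e A m = 1 ∧ ∀ i > 0, i < m → octadVector e A i = 0

/-- The class of a place `c`: the pair vectors with the entry `2` at `c` and the octad vectors whose
sign pattern is in the class owned by the index of `c` in the octad. -/
def placeClass (o : Bool) (d c : Fin 24) : Set (Fin 24 → ℤ) :=
  vectorClass (fun t => t c = 2) fun e A =>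
    ∃ g, e g = c ∧ A ∈ patternClass (decide (∃ k, e k = 0)) (o && decide (∃ k, e k = d)) g

theorem neg_four_lt_dotProduct_octadVector {t : Fin 24 → ℤ} {e : Fin 8 ↪o Fin 24}
    {A : Finset (Fin 8)} (hpair : IsPairVector t) (ht0 : 0 ≤ t 0) (ht : ∀ i ≠ 0, t i ≤ 0)
    (hA : A = ∅ ∨ #A = 2 ∧ octadVector e A 0 = 1) : -4 < t ⬝ᵥ octadVector e A := by
  by_contra! hdot
  have hopp : ∀ c, t c ≠ 0 → t c = -2 * octadVector e A c := fun c =>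
    hpair.eq_neg_two_mul_of_dotProduct_le (abs_signVector_le_one _ _) hdot
  have hplus : ∀ c ≠ 0, t c ≠ 0 → ∃ k ∈ A, e k = c := fun c hc htc =>
    octadVector_eq_one_iff.1 (by
      have := hpair.apply_eq c
      have := ht c hc
      have := hopp c htc
      omega)
  obtain ⟨c, hc, htc⟩ := hpair.exists_ne 0
  obtain ⟨k, hk, rfl⟩ := hplus c hc htc
  obtain rfl | ⟨hA2, hA0⟩ := hA
  · exact notMem_empty k hk
  obtain ⟨j, hjk, htj⟩ := hpair.exists_ne (e k)
  have hj : j ≠ 0 := by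
    rintro rfl
    have := hopp 0 htj
    omega
  obtain ⟨l, hl, rfl⟩ := hplus j hj htj
  obtain ⟨m, hm, hm0⟩ := octadVector_eq_one_iff.1 hA0
  rw [← hm0, e.injective.ne_iff] at hc hj
  have := two_lt_card.2 ⟨m, hm, k, hk, l, hl, hc.symm, hj.symm, (e.injective.ne_iff.1 hjk).symm⟩
  omega

theorem neg_four_lt_dotProduct_of_mem_firstClass :
    ∀ t ∈ firstClass, ∀ u ∈ firstClass, -4 < t ⬝ᵥ u := by
  have hcard : ∀ {e A}, A = ∅ ∨ #A = 2 ∧ octadVector e A 0 = 1 → #A ≤ 2 := by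
    rintro e A (rfl | ⟨hA, -⟩)
    exacts [zero_le, hA.le]
  have hplus : ∀ {e A}, A = ∅ ∨ #A = 2 ∧ octadVector e A 0 = 1 → #A = 2 →
      octadVector e A 0 = 1 := by
    rintro e A (rfl | ⟨-, hA0⟩) hA2
    exacts [by simp at hA2, hA0]
  refine neg_four_lt_dotProduct_of_mem_vectorClass ?_ ?_ ?_ ?_
  · rintro t u - - ⟨ht0, ht⟩ ⟨hu0, hu⟩
    refine neg_four_lt_dotProduct_of_forall_mul_nonneg fun i => ?_
    rcases eq_or_ne i 0 with rfl | hi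
    · exact mul_nonneg ht0 hu0
    · exact mul_nonneg_of_nonpos_of_nonpos (ht i hi) (hu i hi)
  · rintro t e A hpair ⟨ht0, ht⟩ hA
    exact neg_four_lt_dotProduct_octadVector hpair ht0 ht hA
  · intro e f A B hef hA hB
    by_contra! hdot
    obtain ⟨hA2, hopp⟩ :=
      octadVector_opposite_of_dotProduct_le hef (hcard hA) (hcard hB) hdot
    rw [dotProduct_comm] at hdot
    obtain ⟨hB2, -⟩ := octadVector_opposite_of_dotProduct_le (by rwa [inter_comm]) (hcard hB)
      (hcard hA) hdot
    have := hopp 0 (hplus hA hA2)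
    have := hplus hB hB2
    omega
  · intro e A B hA hB
    have := hcard hA
    have := hcard hB
    have := card_symmDiff_add A B
    omega

theorem neg_four_lt_dotProduct_of_mem_lastClass (o : Bool) (d : Fin 24) :
    ∀ t ∈ lastClass o d, ∀ u ∈ lastClass o d, -4 < t ⬝ᵥ u := by
  refine neg_four_lt_dotProduct_of_mem_vectorClass ?_ ?_ ?_ ?_
  · rintro t u - - ⟨ht, -⟩ ⟨hu, -⟩
    refine neg_four_lt_dotProduct_of_forall_mul_nonneg fun i => ?_
    have hti := ht i
    have hui := hu i
    split_ifs at hti hui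
    · exact mul_nonneg hti hui
    · exact mul_nonneg_of_nonpos_of_nonpos hti hui
  · rintro t e A hpair ⟨-, ht⟩ ⟨-, h0, hd, -⟩
    by_contra! hdot
    have hopp := fun c => hpair.eq_neg_two_mul_of_dotProduct_le (c := c)
      (abs_signVector_le_one _ _) hdot
    have h0val := hpair.apply_eq 0
    have hdval := hpair.apply_eq d
    have h0opp := hopp 0
    have hdopp := hopp d
    rw [← octadVector] at h0opp hdopp
    rcases ht with ht | ⟨ho, ht⟩
    · omega
    · have := hd ho
      omega
  · rintro e f A B hef ⟨hA, -, -, m, hm, hAm, hAlt⟩ ⟨hB, -, -, m', hm', hBm', hBlt⟩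
    by_contra! hdot
    have hABm := (octadVector_opposite_of_dotProduct_le hef hA.le hB.le hdot).2 m hAm
    rw [dotProduct_comm] at hdot
    have hBAm' := (octadVector_opposite_of_dotProduct_le (by rwa [inter_comm]) hB.le hA.le
      hdot).2 m' hBm'
    rcases lt_trichotomy m m' with h | rfl | h
    · have := hBlt m hm h
      omega
    · omega
    · have := hAlt m' hm' h
      omega
  · rintro e A B ⟨hA, -⟩ ⟨hB, -⟩
    have := card_symmDiff_add A B
    omega

theorem neg_four_lt_dotProduct_of_mem_placeClass (o : Bool) (d c : Fin 24) :
    ∀ t ∈ placeClass o d c, ∀ u ∈ placeClass o d c, -4 < t ⬝ᵥ u := by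
  have hone : ∀ {e A g}, e g = c →
      A ∈ patternClass (decide (∃ k, e k = 0)) (o && decide (∃ k, e k = d)) g →
      octadVector e A c = 1 := by
    rintro e A g rfl ⟨-, hg, -⟩
    exact octadVector_eq_one_iff.2 ⟨g, (mem_filter.1 hg).1, rfl⟩
  refine neg_four_lt_dotProduct_of_mem_vectorClass ?_ ?_ ?_ ?_
  · intro t u ht hu htc huc
    refine lt_of_lt_of_le (by norm_num) (ht.dotProduct_nonneg htc fun i => ?_)
    rcases hu.apply_eq i with h | h | h <;> simp [h, huc]
  · rintro t e A ht htc ⟨g, hg, hA⟩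
    exact lt_of_lt_of_le (by norm_num) (ht.dotProduct_nonneg htc fun i =>
      (abs_signVector_le_one _ _ i).trans_eq (hone hg hA).symm)
  · rintro e f A B hef ⟨g, hg, hA⟩ ⟨g', hg', hB⟩
    exact lt_of_lt_of_le (by norm_num)
      (neg_two_le_signVector_dotProduct hef (hone hg hA) (hone hg' hB))
  · rintro e A B ⟨g, hg, hA⟩ ⟨g', hg', hB⟩
    obtain rfl := e.injective (hg.trans hg'.symm)
    exact card_symmDiff_le_four_of_mem_patternClass hA hB

end ColourClasses

section Tails

/-- `t` vanishes after the place `d`, and a nonzero entry at `d` is the negative of the last nonzero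
entry before `d`. -/
def HasOppositeTail (d : Fin 24) (t : Fin 24 → ℤ) : Prop :=
  (∀ i > d, t i = 0) ∧ (t d ≠ 0 → ∃ m < d, t m = -t d ∧ ∀ i > m, i < d → t i = 0)

/-- `t` vanishes from the place `d + 2` on, and a nonzero entry at `d` or `d + 1` repeats the entry
before it. -/
def HasRepeatedTail (d : Fin 24) (t : Fin 24 → ℤ) : Prop :=
  (∀ i : Fin 24, d.val + 1 < i → t i = 0) ∧
    ∀ i j : Fin 24, i.val + 1 = j → d ≤ j → t j ≠ 0 → t i = t j

/-- The shape of the last entries of the vectors of the `d`-dimensional lattice, according to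
whether these vectors may end in two opposite entries (`o`) or in up to three equal ones. -/
def HasTail (o : Bool) (d : Fin 24) (t : Fin 24 → ℤ) : Prop :=
  if o then HasOppositeTail d t else HasRepeatedTail d t

/-- The colour classes of the minimal vectors in dimension `d`, numbered from `0` to `d`. -/
def colourClass (o : Bool) (d c : Fin 24) : Set (Fin 24 → ℤ) :=
  if c = 0 then firstClass else if c = d then lastClass o d else placeClass o d c

variable {o : Bool} {d : Fin 24} {t : Fin 24 → ℤ} {e : Fin 8 ↪o Fin 24} {A : Finset (Fin 8)}

theorem neg_four_lt_dotProduct_of_mem_colourClass (o : Bool) (d c : Fin 24) :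
    ∀ t ∈ colourClass o d c, ∀ u ∈ colourClass o d c, -4 < t ⬝ᵥ u := by
  unfold colourClass
  split_ifs
  · exact neg_four_lt_dotProduct_of_mem_firstClass
  · exact neg_four_lt_dotProduct_of_mem_lastClass o d
  · exact neg_four_lt_dotProduct_of_mem_placeClass o d c

theorem firstClass_eq_colourClass : firstClass = colourClass o d 0 := by
  simp [colourClass]

theorem lastClass_eq_colourClass (hd : d ≠ 0) : lastClass o d = colourClass o d d := by
  simp [colourClass, hd]

theorem placeClass_eq_colourClass {c : Fin 24} (hc : 0 < c) (hcd : c < d) :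
    placeClass o d c = colourClass o d c := by
  simp [colourClass, hc.ne', hcd.ne]

namespace IsPairVector

theorem nonpos_of_hasRepeatedTail (ht : IsPairVector t) (hd : 2 ≤ d.val)
    (htail : HasRepeatedTail d t) (hplace : ∀ c > 0, c < d → t c ≠ 2) {i : Fin 24} (hi : 0 < i) :
    t i ≤ 0 := by
  have hle : ∀ j, t j ≠ 2 → t j ≤ 0 := fun j hj => by
    have := ht.apply_eq j
    omega
  have hd2 : t d ≠ 2 := fun h => by
    have := htail.2 ⟨d - 1, by omega⟩ d (by dsimp only; omega) le_rfl (by omega)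
    exact hplace ⟨d - 1, by omega⟩ (Fin.lt_def.2 (by simp; omega)) (Fin.lt_def.2 (by simp; omega))
      (this.trans h)
  rcases lt_trichotomy i d with hid | rfl | hdi
  · exact hle i (hplace i hi hid)
  · exact hle i hd2
  · refine hle i fun h => ?_
    have hi1 : i.val = d + 1 := by
      by_contra hne
      have := htail.1 i (by have := Fin.lt_def.1 hdi; omega)
      omega
    exact hd2 ((htail.2 d i hi1.symm hdi.le (by omega)).trans h)

theorem last_entries_of_hasOppositeTail (ht : IsPairVector t) (hd0 : d ≠ 0)
    (htail : HasOppositeTail d t) (hplace : ∀ c > 0, c < d → t c ≠ 2)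
    (hfirst : ¬(0 ≤ t 0 ∧ ∀ i ≠ 0, t i ≤ 0)) :
    (∀ i, if i = d then 0 ≤ t i else t i ≤ 0) ∧ (t 0 < 0 ∨ 0 < t d) := by
  have hmid : ∀ i ≠ 0, i ≠ d → t i ≤ 0 := fun i hi hid => by
    rcases hid.lt_or_gt with hlt | hgt
    · have := hplace i (Fin.pos_of_ne_zero hi) hlt
      have := ht.apply_eq i
      omega
    · exact (htail.1 i hgt).le
  have hneg : t d ≤ 0 → t 0 < 0 := fun h => lt_of_not_ge fun h0 => hfirst ⟨h0, fun i hi => by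
    rcases eq_or_ne i d with rfl | hid
    exacts [h, hmid i hi hid]⟩
  have hne : t d ≠ -2 := fun h => by
    obtain ⟨m, hmd, htm, -⟩ := htail.2 (by omega)
    have hm0 : m = 0 := by
      by_contra hm
      exact hplace m (Fin.pos_of_ne_zero hm) hmd (by omega)
    have := hneg (by omega)
    rw [hm0] at htm
    omega
  have h0 : t 0 ≤ 0 := by
    by_contra! hpos
    have htd : t d ≠ 0 := fun h => by
      have := hneg h.le
      omega
    obtain ⟨m, hmd, htm, -⟩ := htail.2 htd
    have := ht.apply_eq d
    rcases ht.eq_or_eq_of_ne_zero hpos.ne' htd (k := m) (by omega) hd0.symm with rfl | rfl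
    · omega
    · exact lt_irrefl _ hmd
  have := ht.apply_eq d
  refine ⟨fun i => ?_, ?_⟩
  · split_ifs with hi
    · subst hi; omega
    · rcases eq_or_ne i 0 with rfl | hi0
      exacts [h0, hmid i hi0 hi]
  · by_contra! h
    have := hneg h.2
    omega

theorem exists_mem_colourClass (ht : IsPairVector t) (hd : 1 ≤ d.val) (hod : ¬o → 2 ≤ d.val)
    (htail : HasTail o d t) : ∃ c ≤ d, t ∈ colourClass o d c := by
  have hd0 : d ≠ 0 := fun h => by simp [h] at hd
  by_cases hplace : ∃ c > 0, c < d ∧ t c = 2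
  · obtain ⟨c, hc, hcd, htc⟩ := hplace
    exact ⟨c, hcd.le, placeClass_eq_colourClass hc hcd ▸ .inl ⟨ht, htc⟩⟩
  push Not at hplace
  by_cases hfirst : 0 ≤ t 0 ∧ ∀ i ≠ 0, t i ≤ 0
  · exact ⟨0, Fin.zero_le d, firstClass_eq_colourClass ▸ .inl ⟨ht, hfirst⟩⟩
  refine ⟨d, le_rfl, lastClass_eq_colourClass hd0 ▸ .inl ⟨ht, ?_⟩⟩
  cases o
  · have hle : ∀ i ≠ 0, t i ≤ 0 := fun i hi =>
      ht.nonpos_of_hasRepeatedTail (hod (by simp)) (by simpa [HasTail] using htail) hplace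
        (Fin.pos_of_ne_zero hi)
    have h0 : t 0 < 0 := lt_of_not_ge fun h => hfirst ⟨h, hle⟩
    exact ⟨fun i => by
      rcases eq_or_ne i 0 with rfl | hi
      exacts [by simpa using h0.le, by simpa using hle i hi], .inl h0⟩
  · have hopposite : HasOppositeTail d t := by simpa [HasTail] using htail
    simpa using ht.last_entries_of_hasOppositeTail hd0 hopposite hplace hfirst

end IsPairVector

theorem HasOppositeTail.eq_seven_and_six_mem_iff (htail : HasOppositeTail d (octadVector e A))
    {k : Fin 8} (hk : e k = d) : k = 7 ∧ (6 ∈ A ↔ 7 ∉ A) := by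
  have hne : ∀ l, octadVector e A (e l) ≠ 0 := fun l => octadVector_ne_zero_iff.2 ⟨l, rfl⟩
  obtain rfl : k = 7 := by
    by_contra hk7
    exact hne 7 (htail.1 _ (hk ▸ e.lt_iff_lt.2 (by omega)))
  obtain ⟨m, hmd, htm, hgap⟩ := htail.2 (hk ▸ hne 7)
  obtain ⟨l, rfl⟩ := octadVector_ne_zero_iff.1 (htm ▸ neg_ne_zero.2 (hk ▸ hne 7))
  obtain rfl : l = 6 := by
    by_contra hl6
    have hl7 : l < 7 := e.lt_iff_lt.1 (hk ▸ hmd)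
    exact hne 6 (hgap _ (e.lt_iff_lt.2 (by omega)) (hk ▸ e.lt_iff_lt.2 (by decide)))
  rw [← hk, octadVector_apply, octadVector_apply] at htm
  refine ⟨rfl, ?_⟩
  split_ifs at htm with h6 h7 h7 <;> simp_all

theorem HasRepeatedTail.mem_iff_and_val_add_one (htail : HasRepeatedTail d (octadVector e A))
    {k l : Fin 8} (hkl : k.val + 1 = l) (hdl : d ≤ e l) (hd : d ≠ 0) :
    (k ∈ A ↔ l ∈ A) ∧ (e k).val + 1 = e l := by
  have hl : octadVector e A (e l) ≠ 0 := octadVector_ne_zero_iff.2 ⟨l, rfl⟩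
  have hpos : 0 < (e l).val := Fin.lt_def.1 ((Fin.pos_of_ne_zero hd).trans_le hdl)
  have hrep := htail.2 ⟨e l - 1, by omega⟩ (e l) (by dsimp only; omega) hdl hl
  obtain ⟨j, hj⟩ := octadVector_ne_zero_iff.1 (hrep ▸ hl)
  have hjl : j < l := e.lt_iff_lt.1 (by rw [hj, Fin.lt_def]; dsimp only; omega)
  have hkj : e j ≤ e k := e.le_iff_le.2 (by omega)
  have hkl' : e k < e l := e.lt_iff_lt.2 (by omega)
  have hek : (e k).val + 1 = e l := by
    rw [hj] at hkj
    simp only [Fin.lt_def, Fin.le_def] at hkj hkl'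
    omega
  have hprev : (⟨e l - 1, by omega⟩ : Fin 24) = e k := Fin.ext (by dsimp only; omega)
  rw [hprev, octadVector_apply, octadVector_apply] at hrep
  refine ⟨?_, hek⟩
  split_ifs at hrep with h6 h7 h7 <;> simp_all

theorem HasRepeatedTail.lt_of_mem_usableIndices {z : Bool} {g : Fin 8}
    (htail : HasRepeatedTail d (octadVector e A)) (hd : d ≠ 0)
    (hg : g ∈ usableIndices z false A) : e g < d := by
  by_contra! hge
  have hgap : ∀ l ≥ g, d ≤ e l := fun l hl => hge.trans (e.le_iff_le.2 hl)
  have h67 := htail.mem_iff_and_val_add_one (k := 6) (l := 7) rfl (hgap 7 (by omega)) hd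
  simp only [usableIndices, mem_filter, Bool.false_eq_true, if_false] at hg
  obtain ⟨hg7, hg6⟩ := hg.2.2 h67.1
  have hg6' : g ≠ 6 := by
    rintro rfl
    exact hg6 (htail.mem_iff_and_val_add_one (k := 5) (l := 6) rfl (hgap 6 le_rfl) hd).1 rfl
  have h56 := htail.mem_iff_and_val_add_one (k := 5) (l := 6) rfl (hgap 6 (by omega)) hd
  have h5 := Fin.le_def.1 (hgap 5 (by omega))
  exact octadVector_ne_zero_iff.2 ⟨7, rfl⟩ (htail.1 (e 7) (by omega))

theorem HasOppositeTail.lt_of_mem_usableIndices {z : Bool} {g : Fin 8}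
    (htail : HasOppositeTail d (octadVector e A))
    (hg : g ∈ usableIndices z (decide (∃ k, e k = d)) A) : e g < d := by
  rcases lt_trichotomy (e g) d with h | h | h
  · exact h
  · obtain ⟨rfl, -⟩ := htail.eq_seven_and_six_mem_iff h
    simp [usableIndices, show ∃ k, e k = d from ⟨7, h⟩] at hg
  · exact absurd (htail.1 _ h) (octadVector_ne_zero_iff.2 ⟨g, rfl⟩)

theorem exists_mem_colourClass_of_isOrdinaryPattern (he : IsOctad e) (hd : d ≠ 0)
    (htail : HasTail o d (octadVector e A))
    (hA : IsOrdinaryPattern (decide (∃ k, e k = 0)) (o && decide (∃ k, e k = d)) A) :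
    ∃ c ≤ d, octadVector e A ∈ colourClass o d c := by
  obtain ⟨g, hg⟩ := hA.exists_mem_patternClass
  have hpos : 0 < e g := Fin.pos_of_ne_zero fun h0 => by
    have hg0 : g ≠ 0 := (mem_filter.1 hg.2.1).2.1 (decide_eq_true ⟨g, h0⟩)
    exact absurd (e.lt_iff_lt.2 (Fin.pos_of_ne_zero hg0)) (by simp [h0])
  have hlt : e g < d := by
    cases o
    · exact HasRepeatedTail.lt_of_mem_usableIndices (by simpa [HasTail] using htail) hd hg.2.1
    · exact HasOppositeTail.lt_of_mem_usableIndices (by simpa [HasTail] using htail) hg.2.1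
  exact ⟨e g, hlt.le, placeClass_eq_colourClass hpos hlt ▸ .inr ⟨e, A, he, ⟨g, rfl, hg⟩, rfl⟩⟩

/-- The first place of the octad `e` after the first place of all. -/
def firstIndex (e : Fin 8 ↪o Fin 24) : Fin 8 :=
  if ∃ k, e k = 0 then 1 else 0

theorem firstIndex_pos (e : Fin 8 ↪o Fin 24) : 0 < e (firstIndex e) := by
  unfold firstIndex
  split_ifs with h
  · exact (Fin.zero_le _).trans_lt (e.lt_iff_lt.2 (show (0 : Fin 8) < 1 by decide))
  · exact Fin.pos_of_ne_zero fun h0 => h ⟨0, h0⟩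

theorem octadVector_eq_zero_of_lt_firstIndex {i : Fin 24} (hi : 0 < i)
    (hlt : i < e (firstIndex e)) : octadVector e A i = 0 := by
  by_contra hne
  obtain ⟨k, rfl⟩ := octadVector_ne_zero_iff.1 hne
  have hk := e.lt_iff_lt.1 hlt
  unfold firstIndex at hk
  split_ifs at hk with h
  · obtain ⟨j, hj⟩ := h
    obtain rfl : k = 0 := by omega
    exact absurd (e.lt_iff_lt.1 (hj ▸ hi)) (by simp)
  · simp at hk

theorem octadVector_zero_eq_one (h : ∃ k, e k = 0) (hA : 0 ∈ A) : octadVector e A 0 = 1 := by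
  obtain ⟨k, hk⟩ := h
  have h0 : e 0 ≤ 0 := hk ▸ e.le_iff_le.2 (Fin.zero_le k)
  exact octadVector_eq_one_iff.2 ⟨0, hA, nonpos_iff_eq_zero.1 h0⟩

theorem exists_mem_colourClass_of_octadVector (he : IsOctad e) (hA : Even #A) (hd : d ≠ 0)
    (htail : HasTail o d (octadVector e A)) : ∃ c ≤ d, octadVector e A ∈ colourClass o d c := by
  by_cases hfirst : A = ∅ ∨ #A = 2 ∧ octadVector e A 0 = 1
  · exact ⟨0, Fin.zero_le d, firstClass_eq_colourClass ▸ .inr ⟨e, A, he, hfirst, rfl⟩⟩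
  push Not at hfirst
  have hopp : o → ∀ k, e k = d → k = 7 ∧ (6 ∈ A ↔ 7 ∉ A) := fun ho k hk =>
    HasOppositeTail.eq_seven_and_six_mem_iff (by simpa [HasTail, ho] using htail) hk
  by_cases hlast : #A = 2 ∧ firstIndex e ∈ A ∧ (o → ∀ k, e k = d → 7 ∈ A)
  · obtain ⟨hA2, hmem, h7⟩ := hlast
    refine ⟨d, le_rfl, lastClass_eq_colourClass hd ▸ .inr ⟨e, A, he, ⟨hA2, hfirst.2 hA2, ?_,
      e (firstIndex e), firstIndex_pos e, octadVector_eq_one_iff.2 ⟨_, hmem, rfl⟩,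
      fun i hi hlt => octadVector_eq_zero_of_lt_firstIndex hi hlt⟩, rfl⟩⟩
    intro ho hneg
    obtain ⟨k, hk⟩ := octadVector_ne_zero_iff.1 (show octadVector e A d ≠ 0 by omega)
    obtain ⟨rfl, -⟩ := hopp ho k hk
    have := octadVector_eq_one_iff.2 ⟨7, h7 ho 7 hk, hk⟩
    omega
  refine exists_mem_colourClass_of_isOrdinaryPattern he hd htail ⟨hA, hfirst.1.ne_empty, ?_, ?_⟩
  · simp only [Bool.and_eq_true, decide_eq_true_eq]
    rintro ⟨ho, k, hk⟩
    exact (hopp ho k hk).2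
  · intro hA2
    simp only [Bool.and_eq_true, decide_eq_true_eq]
    refine ⟨fun hz h0 => hfirst.2 hA2 (octadVector_zero_eq_one hz h0), fun hmem => ?_⟩
    have h7 : ¬(o → ∀ k, e k = d → 7 ∈ A) := fun h => hlast ⟨hA2, hmem, h⟩
    push Not at h7
    obtain ⟨ho, k, hk, h7⟩ := h7
    exact ⟨⟨ho, k, hk⟩, h7⟩

end Tails

section Conditions

/-- The coefficients, in the order of `coordOrder`, of the linear form that vanishes on the vectors
satisfying `addedCondition · m`. For `m = 0`, where there is no condition, it is the first entry. -/
def conditionForm (m : Fin 24) : Fin 24 → ℤ :=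
  if m ∈ ({2, 14, 18} : Finset (Fin 24)) then
    Pi.single m 1 + Pi.single (m - 1) 1 + Pi.single (m - 2) 1
  else if m ∈ ({6, 7, 10, 11, 22, 23} : Finset (Fin 24)) then Pi.single m 1 - Pi.single (m - 1) 1
  else if m ∈ ({1, 12, 13, 16, 17} : Finset (Fin 24)) then Pi.single (m + 1) 1
  else Pi.single m 1

theorem addedCondition_iff (x : Fin 24 → ℤ) {m : Fin 24} (hm : m ≠ 0) :
    addedCondition x m ↔ conditionForm m ⬝ᵥ (x ∘ placeOrder) = 0 := by
  fin_cases m <;>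
    simp [addedCondition, conditionForm, add_dotProduct, sub_dotProduct, sub_eq_zero] at hm ⊢ <;>
    rfl

/-- The largest dimension whose lattice vanishes at the given place, with the value `0` for the
first two places, at which no lattice vanishes. -/
def vanishingDim : Fin 24 → Fin 24 :=
  ![0, 0, 1, 3, 4, 5, 5, 5, 8, 9, 9, 9, 12, 12, 13, 15, 16, 16, 17, 19, 20, 21, 21, 21]

theorem vanishingDim_le_add (i : Fin 24) :
    vanishingDim i ≤ vanishingDim i + 1 ∧ vanishingDim i ≤ vanishingDim i + 2 := by
  decide +revert

variable {d i : Fin 24} {t : Fin 24 → ℤ}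

theorem apply_eq_zero_of_le_vanishingDim (h : ∀ m ≥ d, conditionForm m ⬝ᵥ t = 0) (hi : 2 ≤ i)
    (hd : d ≤ vanishingDim i) : t i = 0 := by
  have h0 := h _ hd
  have h1 := h _ (hd.trans (vanishingDim_le_add i).1)
  have h2 := h _ (hd.trans (vanishingDim_le_add i).2)
  clear hd h
  fin_cases i <;>
    simp [vanishingDim, conditionForm, add_dotProduct, sub_dotProduct] at hi h0 h1 h2 ⊢ <;> omega

/-- The dimensions in which the last condition, or the last but one, is on the sum of three
coordinates, so that the minimal vectors may end in two opposite entries. -/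
def oppositeDims : Finset (Fin 24) := {1, 2, 13, 14, 17, 18}

theorem le_vanishingDim_of_mem_oppositeDims :
    ∀ d ∈ oppositeDims, ∀ i > d, 2 ≤ i ∧ d ≤ vanishingDim i := by
  decide

theorem le_vanishingDim_of_notMem_oppositeDims : ∀ d ∉ oppositeDims, d ≠ 0 → d ≤ 21 →
    (∀ i : Fin 24, d.val + 1 < i → 2 ≤ i ∧ d ≤ vanishingDim i) ∧
      ∀ i ≥ d, i ∈ ({6, 7, 10, 11} : Finset (Fin 24)) ∨ 2 ≤ i ∧ d ≤ vanishingDim i := by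
  decide

theorem hasOppositeTail_of_conditionForm (h : ∀ m ≥ d, conditionForm m ⬝ᵥ t = 0)
    (hd : d ∈ oppositeDims) {a : ℤ} (ht : ∀ i, t i = 0 ∨ t i = a ∨ t i = -a) :
    HasOppositeTail d t := by
  refine ⟨fun i hi => ?_, fun htd => ?_⟩
  · obtain ⟨hi2, hle⟩ := le_vanishingDim_of_mem_oppositeDims d hd i hi
    exact apply_eq_zero_of_le_vanishingDim h hi2 hle
  have hlt : ∀ d ∈ oppositeDims,
      d ≤ d + 1 ∧ d - 1 < d ∧ (2 ≤ d → d - 2 < d ∧ ∀ i > d - 2, i < d → i = d - 1) := by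
    decide
  obtain ⟨hd1, hsub1, hsub2⟩ := hlt d hd
  have hcases : t (d - 1) = -t d ∨ 2 ≤ d ∧ t (d - 1) = 0 ∧ t (d - 2) = -t d := by
    have h0 := h d le_rfl
    have h1 := h (d + 1) hd1
    have := ht d
    have := ht (d - 1)
    have := ht (d - 2)
    simp only [oppositeDims, mem_insert, mem_singleton] at hd
    rcases hd with rfl | rfl | rfl | rfl | rfl | rfl <;>
      simp [conditionForm, add_dotProduct] at * <;> omega
  rcases hcases with h1 | ⟨hd2, h1, h2⟩
  · refine ⟨d - 1, hsub1, h1, fun i hi hid => ?_⟩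
    omega
  · exact ⟨d - 2, (hsub2 hd2).1, h2, fun i hi hid => (hsub2 hd2).2 i hi hid ▸ h1⟩

theorem hasRepeatedTail_of_conditionForm (h : ∀ m ≥ d, conditionForm m ⬝ᵥ t = 0)
    (hd0 : d ≠ 0) (hd : d ∉ oppositeDims) (hd21 : d ≤ 21) : HasRepeatedTail d t := by
  obtain ⟨hzero, hrep⟩ := le_vanishingDim_of_notMem_oppositeDims d hd hd0 hd21
  refine ⟨fun i hi => apply_eq_zero_of_le_vanishingDim h (hzero i hi).1 (hzero i hi).2,
    fun i j hij hdj htj => ?_⟩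
  rcases hrep j hdj with hj | ⟨hj, hle⟩
  · obtain rfl : i = j - 1 := by omega
    have hdiff : conditionForm j ⬝ᵥ t = t j - t (j - 1) := by
      simp only [mem_insert, mem_singleton] at hj
      rcases hj with rfl | rfl | rfl | rfl <;> simp [conditionForm, sub_dotProduct]
    exact (sub_eq_zero.1 (hdiff ▸ h j hdj)).symm
  · exact absurd (apply_eq_zero_of_le_vanishingDim h hj hle) htj

end Conditions

section Dimension

variable {n : ℕ}

/-- The point whose coordinates, in the order of `coordOrder`, are the entries of `t`. -/
noncomputable def placeVector : (Fin 24 → ℤ) →+ EuclideanSpace ℝ (Fin 24) where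
  toFun t := toEuclidean24 (t ∘ placeOrder.symm)
  map_zero' := by ext; simp [toEuclidean24]
  map_add' t u := by ext; simp [toEuclidean24]

theorem inner_placeVector (t u : Fin 24 → ℤ) :
    inner ℝ (placeVector t) (placeVector u) = ((t ⬝ᵥ u : ℤ) : ℝ) := by
  rw [← comp_equiv_dotProduct_comp_equiv t u placeOrder.symm]
  simp [placeVector, toEuclidean24, PiLp.inner_apply, dotProduct, mul_comm]

theorem norm_placeVector_sq (t : Fin 24 → ℤ) : ‖placeVector t‖ ^ 2 = ((t ⬝ᵥ t : ℤ) : ℝ) := by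
  rw [← real_inner_self_eq_norm_sq, inner_placeVector]

theorem mem_laminatedLattice_iff (hn : 1 ≤ n) {v : EuclideanSpace ℝ (Fin 24)} :
    v ∈ laminatedLattice n ↔ ∃ t, t ∘ placeOrder.symm ∈ leechLattice ∧
      (∀ m : Fin 24, n ≤ m → conditionForm m ⬝ᵥ t = 0) ∧ placeVector t = v := by
  have hcond : ∀ x : Fin 24 → ℤ, (∀ m, n ≤ m → m ≤ 23 → addedCondition x m) ↔
      ∀ m : Fin 24, n ≤ m → conditionForm m ⬝ᵥ (x ∘ placeOrder) = 0 := fun x => by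
    refine ⟨fun h m hm => (addedCondition_iff x ?_).1 (h m hm (by omega)), fun h m hm hm23 =>
      (addedCondition_iff x (m := ⟨m, by omega⟩) ?_).2 (h _ hm)⟩
    · rintro rfl
      simp at hm; omega
    · exact Fin.ne_of_val_ne (by simp; omega)
  constructor
  · rintro ⟨x, ⟨hx, hcondx⟩, rfl⟩
    refine ⟨x ∘ placeOrder, by simpa [Function.comp_assoc] using hx, (hcond x).1 hcondx, ?_⟩
    simp [placeVector, Function.comp_assoc]
  · rintro ⟨t, ht, hform, rfl⟩
    exact ⟨_, ⟨ht, (hcond _).2 (by simpa [Function.comp_assoc] using hform)⟩, rfl⟩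

theorem four_smul_mem_leechLattice {u : Fin 24 → ℤ} (hu : Even (∑ i, u i)) :
    4 • u ∈ leechLattice := by
  refine ⟨0, .inl rfl, 0, golayCode.zero_mem, fun i => u i % 2, fun i => u i / 2,
    fun i => Int.emod_two_eq (u i), ?_, fun i => ?_⟩
  · rw [Int.ModEq, ← sum_int_mod, Int.even_iff.1 hu]
    rfl
  · simp only [Pi.smul_apply, Pi.zero_apply, ZMod.val_zero]
    have := Int.mul_ediv_add_emod (u i) 2
    simp
    omega

theorem placeVector_four_smul_mem_laminatedLattice (hn : 1 ≤ n) {u : Fin 24 → ℤ}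
    (hu : Even (∑ i, u i)) (hform : ∀ m : Fin 24, n ≤ m → conditionForm m ⬝ᵥ u = 0) :
    placeVector (4 • u) ∈ laminatedLattice n := by
  refine (mem_laminatedLattice_iff hn).2 ⟨4 • u, ?_, fun m hm => ?_, rfl⟩
  · exact four_smul_mem_leechLattice (u := u ∘ placeOrder.symm)
      (by simpa [Equiv.sum_comp placeOrder.symm u] using hu)
  · rw [dotProduct_smul, hform m hm, smul_zero]

/-- A vector, in place order, that satisfies the conditions for dimension `n + 1` and violates the
condition added at dimension `n`. A multiple of it lies in the Leech lattice. -/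
def newVector (n : Fin 24) : Fin 24 → ℤ :=
  if n ∈ ({0, 1, 12, 13, 16, 17} : Finset (Fin 24)) then Pi.single (n + 1) 1 - Pi.single n 1
  else if n ∈ ({5, 9, 21} : Finset (Fin 24)) then
    Pi.single n 1 + Pi.single (n + 1) 1 + Pi.single (n + 2) 1
  else if n ∈ ({6, 10, 22} : Finset (Fin 24)) then Pi.single n 1 + Pi.single (n + 1) 1
  else Pi.single n 1

theorem conditionForm_dotProduct_newVector_of_lt :
    ∀ n m : Fin 24, n < m → conditionForm m ⬝ᵥ newVector n = 0 := by
  decide +kernel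

theorem conditionForm_dotProduct_newVector_self_ne_zero :
    ∀ n : Fin 24, conditionForm n ⬝ᵥ newVector n ≠ 0 := by
  decide +kernel

theorem laminatedLattice_mono {m n : ℕ} (h : m ≤ n) : laminatedLattice m ⊆ laminatedLattice n :=
  Set.image_mono fun _ hx => ⟨hx.1, fun k hk => hx.2 k (h.trans hk)⟩

theorem placeVector_newVector_mem (k : Fin 24) :
    placeVector (4 • 2 • newVector k) ∈ laminatedLattice (k + 1) := by
  refine placeVector_four_smul_mem_laminatedLattice (by omega) ?_ fun m hm => ?_
  · exact ⟨∑ i, newVector k i, by simp only [two_nsmul, Pi.add_apply, sum_add_distrib]⟩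
  · rw [dotProduct_smul, conditionForm_dotProduct_newVector_of_lt k m hm, smul_zero]

theorem inner_conditionForm_newVector_ne_zero (k : Fin 24) :
    inner ℝ (placeVector (conditionForm k)) (placeVector (4 • 2 • newVector k)) ≠ 0 := by
  rw [inner_placeVector, dotProduct_smul, dotProduct_smul]
  simpa using conditionForm_dotProduct_newVector_self_ne_zero k

theorem inner_conditionForm_eq_zero_of_mem_span {k : Fin 24} (hk : k ≠ 0)
    {v : EuclideanSpace ℝ (Fin 24)} (hv : v ∈ Submodule.span ℝ (laminatedLattice k)) :
    inner ℝ (placeVector (conditionForm k)) v = 0 := by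
  rw [← Submodule.mem_orthogonal_singleton_iff_inner_right]
  refine Submodule.span_le.2 (fun w hw => ?_) hv
  obtain ⟨t, -, hform, rfl⟩ := (mem_laminatedLattice_iff (by omega)).1 hw
  rw [SetLike.mem_coe, Submodule.mem_orthogonal_singleton_iff_inner_right, inner_placeVector,
    hform k le_rfl, Int.cast_zero]

theorem span_laminatedLattice_lt_span {k : Fin 24} (hk : k ≠ 0) :
    Submodule.span ℝ (laminatedLattice k) < Submodule.span ℝ (laminatedLattice (k + 1)) := by
  refine (Submodule.span_mono (laminatedLattice_mono (Nat.le_succ k))).lt_of_ne fun h => ?_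
  have hmem := Submodule.subset_span (R := ℝ) (placeVector_newVector_mem k)
  rw [SetLike.mem_coe, ← h] at hmem
  exact inner_conditionForm_newVector_ne_zero k (inner_conditionForm_eq_zero_of_mem_span hk hmem)

theorem finrank_span_laminatedLattice_one_pos :
    0 < Module.finrank ℝ (Submodule.span ℝ (laminatedLattice 1)) := by
  rw [Module.finrank_pos_iff, Submodule.nontrivial_iff_ne_bot]
  intro h
  have hmem := Submodule.subset_span (R := ℝ) (placeVector_newVector_mem 0)
  rw [SetLike.mem_coe, show (0 : Fin 24).val + 1 = 1 from rfl, h, Submodule.mem_bot] at hmem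
  exact inner_conditionForm_newVector_ne_zero 0 (hmem ▸ inner_zero_right _)

theorem finrank_span_laminatedLattice (hn : 1 ≤ n) (hn24 : n ≤ 24) :
    Module.finrank ℝ (Submodule.span ℝ (laminatedLattice n)) = n := by
  have hlt : ∀ k, 1 ≤ k → k < 24 → Module.finrank ℝ (Submodule.span ℝ (laminatedLattice k)) <
      Module.finrank ℝ (Submodule.span ℝ (laminatedLattice (k + 1))) := fun k hk hk24 =>
    Submodule.finrank_lt_finrank_of_lt
      (span_laminatedLattice_lt_span (k := ⟨k, hk24⟩) (Fin.ne_of_val_ne (by simp; omega)))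
  refine le_antisymm ?_ ?_
  · induction hn24 using Nat.decreasingInduction with
    | self => exact (Submodule.finrank_le _).trans (by simp)
    | of_succ k hk ih =>
      have := hlt k hn hk
      have := ih (by omega)
      omega
  · induction n, hn using Nat.le_induction with
    | base => exact finrank_span_laminatedLattice_one_pos
    | succ k hk ih =>
      have := hlt k hk (by omega)
      have := ih (by omega)
      omega

end Dimension

section Division

variable {m k : ℕ} {S T : Set (EuclideanSpace ℝ (Fin m))} {r d : ℝ}

theorem DivisibleInto.mono (hT : DivisibleInto T k d) (hST : S ⊆ T) : DivisibleInto S k d := by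
  obtain ⟨P, hcover, hdisj, hdiam⟩ := hT
  refine ⟨fun i => P i ∩ S, ?_, fun i j hij => ?_, fun i => ⟨?_, ?_⟩⟩
  · rw [← Set.iUnion_inter, hcover, Set.inter_eq_right.2 hST]
  · exact (hdisj i j hij).mono Set.inter_subset_left Set.inter_subset_left
  · exact (hdiam i).1.subset Set.inter_subset_left
  · exact (Metric.diam_mono Set.inter_subset_left (hdiam i).1).trans_lt (hdiam i).2

theorem DivisibleInto.of_subset_iUnion {Q : Fin k → Set (EuclideanSpace ℝ (Fin m))}
    (hr : 0 ≤ r) (hrd : r < d) (hS : S ⊆ ⋃ i, Q i)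
    (hdist : ∀ i, ∀ v ∈ Q i, ∀ w ∈ Q i, dist v w ≤ r) : DivisibleInto S k d := by
  have hcolour : ∀ v : S, ∃ i, v.1 ∈ Q i := fun v => Set.mem_iUnion.1 (hS v.2)
  choose colour hcolour using hcolour
  have hle : ∀ i, ∀ v ∈ Subtype.val '' (colour ⁻¹' {i}), ∀ w ∈ Subtype.val '' (colour ⁻¹' {i}),
      dist v w ≤ r := by
    rintro i _ ⟨v, rfl, rfl⟩ _ ⟨w, hw, rfl⟩
    exact hdist _ _ (hcolour v) _ (Set.mem_singleton_iff.1 hw ▸ hcolour w)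
  refine ⟨fun i => Subtype.val '' (colour ⁻¹' {i}), ?_, fun i j hij => ?_, fun i =>
    ⟨Metric.isBounded_iff.2 ⟨r, fun v hv w hw => hle i v hv w hw⟩,
      (Metric.diam_le_of_forall_dist_le hr (hle i)).trans_lt hrd⟩⟩
  · rw [← Set.image_iUnion, ← Set.preimage_iUnion, Set.iUnion_of_singleton, Set.preimage_univ,
      Set.image_univ, Subtype.range_coe]
  · exact (Set.disjoint_image_iff Subtype.val_injective).2
      ((Set.disjoint_singleton.2 hij).preimage colour)

end Division

section MinimalVectors

variable {n : ℕ} {t u : Fin 24 → ℤ} {d : Fin 24} {S : Set (EuclideanSpace ℝ (Fin 24))}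

theorem exists_isHalfLeech_of_mem_laminatedLattice (hn : 1 ≤ n) (hn21 : n ≤ 21)
    {v : EuclideanSpace ℝ (Fin 24)} (hv : v ∈ laminatedLattice n) :
    ∃ t, IsHalfLeech t ∧ (∀ m : Fin 24, n ≤ m → conditionForm m ⬝ᵥ t = 0) ∧
      placeVector (2 • t) = v := by
  obtain ⟨s, hs, hform, rfl⟩ := (mem_laminatedLattice_iff hn).1 hv
  have hs21 : s 21 = 0 := apply_eq_zero_of_le_vanishingDim (d := 21)
    (fun m hm => hform m (hn21.trans hm)) (by decide) (by decide)
  obtain ⟨t, ht, hst⟩ := exists_isHalfLeech_of_mem_leechLattice hs (j := placeOrder 21)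
    (by simpa using hs21)
  obtain rfl : s = 2 • t := by simpa [Function.comp_assoc] using hst
  refine ⟨t, ht, fun m hm => ?_, rfl⟩
  simpa only [dotProduct_smul, smul_eq_zero, OfNat.ofNat_ne_zero, false_or] using hform m hm

theorem dotProduct_self_eq_sum_sq (t : Fin 24 → ℤ) : t ⬝ᵥ t = ∑ i, t i ^ 2 :=
  sum_congr rfl fun i _ => (sq (t i)).symm

theorem norm_placeVector_two_smul (t : Fin 24 → ℤ) :
    ‖placeVector (2 • t)‖ = √32 ↔ ∑ i, t i ^ 2 = 8 := by
  rw [eq_comm, Real.sqrt_eq_iff_eq_sq (by norm_num) (norm_nonneg _), norm_placeVector_sq,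
    smul_dotProduct, dotProduct_smul, dotProduct_self_eq_sum_sq, smul_smul, nsmul_eq_mul]
  norm_cast
  omega

theorem dist_placeVector_two_smul_sq (ht : ∑ i, t i ^ 2 = 8) (hu : ∑ i, u i ^ 2 = 8) :
    dist (placeVector (2 • t)) (placeVector (2 • u)) ^ 2 = 64 - 8 * ((t ⬝ᵥ u : ℤ) : ℝ) := by
  rw [dist_eq_norm, ← map_sub, norm_placeVector_sq]
  have hsum : (2 • t - 2 • u) ⬝ᵥ (2 • t - 2 • u) = 64 - 8 * (t ⬝ᵥ u) := by
    rw [← dotProduct_self_eq_sum_sq] at ht hu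
    rw [← smul_sub, smul_dotProduct, dotProduct_smul]
    simp only [sub_dotProduct, dotProduct_sub, ht, hu, dotProduct_comm u t, nsmul_eq_mul]
    ring
  exact_mod_cast hsum

theorem exists_mem_colourClass_of_isHalfLeech (ht : IsHalfLeech t) (hsq : ∑ i, t i ^ 2 = 8)
    (hd : d ≠ 0) (hd21 : d ≤ 21) (hform : ∀ m ≥ d, conditionForm m ⬝ᵥ t = 0) :
    ∃ c ≤ d, t ∈ colourClass (decide (d ∈ oppositeDims)) d c := by
  have htail : ∀ a, (∀ i, t i = 0 ∨ t i = a ∨ t i = -a) →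
      HasTail (decide (d ∈ oppositeDims)) d t := fun a ha => by
    by_cases hopp : d ∈ oppositeDims
    · simpa [HasTail, hopp] using hasOppositeTail_of_conditionForm hform hopp ha
    · simpa [HasTail, hopp] using hasRepeatedTail_of_conditionForm hform hd hopp hd21
  rcases ht.isPairVector_or_exists_octadVector_eq hsq with hpair | ⟨e, A, he, hA, rfl⟩
  · refine hpair.exists_mem_colourClass (by omega) (fun hopp => ?_) (htail 2 hpair.apply_eq)
    by_contra hlt
    obtain rfl : d = 1 := by omega
    exact hopp rfl
  · refine exists_mem_colourClass_of_octadVector he hA hd (htail 1 fun i => ?_)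
    have hle : |octadVector e A i| ≤ 1 := abs_signVector_le_one _ _ i
    rw [abs_le] at hle
    omega

theorem divisibleInto_minimalVectors (hn : 1 ≤ n) (hn21 : n ≤ 21) :
    DivisibleInto (minimalVectors n) (n + 1) √96 := by
  obtain ⟨d, rfl⟩ : ∃ d : Fin 24, n = d := ⟨⟨n, by omega⟩, rfl⟩
  let Q : Fin (d + 1) → Set (EuclideanSpace ℝ (Fin 24)) := fun c =>
    (fun t => placeVector (2 • t)) ''
      (colourClass (decide (d ∈ oppositeDims)) d (c.castLE (by omega)) ∩ {t | ∑ i, t i ^ 2 = 8})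
  refine DivisibleInto.of_subset_iUnion (Q := Q) (Real.sqrt_nonneg 88)
    (Real.sqrt_lt_sqrt (by norm_num) (by norm_num)) ?_ ?_
  · rintro v ⟨hv, hnorm⟩
    obtain ⟨t, ht, hform, rfl⟩ := exists_isHalfLeech_of_mem_laminatedLattice hn hn21 hv
    have hsq := (norm_placeVector_two_smul t).1 hnorm
    obtain ⟨c, hcd, hc⟩ := exists_mem_colourClass_of_isHalfLeech ht hsq
      (Fin.ne_of_val_ne (by simp; omega)) hn21 hform
    exact Set.mem_iUnion.2 ⟨⟨c, by omega⟩, t, ⟨hc, hsq⟩, rfl⟩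
  · rintro c _ ⟨t, ⟨htc, ht⟩, rfl⟩ _ ⟨u, ⟨huc, hu⟩, rfl⟩
    have hdot : (-3 : ℝ) ≤ (t ⬝ᵥ u : ℤ) := by
      exact_mod_cast neg_four_lt_dotProduct_of_mem_colourClass _ _ _ t htc u huc
    refine Real.le_sqrt_of_sq_le ?_
    rw [dist_placeVector_two_smul_sq ht hu]
    linarith

theorem neg_notMem_of_mem_halfSystems (hS : S ∈ halfSystems n) {v : EuclideanSpace ℝ (Fin 24)}
    (hv : v ∈ S) : -v ∉ S := fun hneg => by
  rcases hS.2 v (hS.1 hv) with h | h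
  exacts [h.2 hneg, h.2 hv]

theorem dist_le_of_mem_halfSystems (hn : 1 ≤ n) (hn21 : n ≤ 21) (hS : S ∈ halfSystems n)
    {v w : EuclideanSpace ℝ (Fin 24)} (hv : v ∈ S) (hw : w ∈ S) : dist v w ≤ √96 := by
  obtain ⟨t, ht, -, rfl⟩ := exists_isHalfLeech_of_mem_laminatedLattice hn hn21 (hS.1 hv).1
  obtain ⟨u, hu, -, rfl⟩ := exists_isHalfLeech_of_mem_laminatedLattice hn hn21 (hS.1 hw).1
  have htsq := (norm_placeVector_two_smul t).1 (hS.1 hv).2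
  have husq := (norm_placeVector_two_smul u).1 (hS.1 hw).2
  have hne : t + u ≠ 0 := fun h => by
    obtain rfl := eq_neg_of_add_eq_zero_right h
    exact neg_notMem_of_mem_halfSystems hS hv (by simpa using hw)
  have hsum : ∑ i, (t + u) i ^ 2 = 16 + 2 * (t ⬝ᵥ u) := by
    rw [← dotProduct_self_eq_sum_sq] at htsq husq ⊢
    simp only [add_dotProduct, dotProduct_add, htsq, husq, dotProduct_comm u t]
    ring
  have hdot : (-4 : ℝ) ≤ (t ⬝ᵥ u : ℤ) := by
    have := (ht.add hu).eight_le_sum_sq hne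
    exact_mod_cast (by omega : -4 ≤ t ⬝ᵥ u)
  refine Real.le_sqrt_of_sq_le ?_
  rw [dist_placeVector_two_smul_sq htsq husq]
  linarith

theorem exists_dist_eq_of_mem_halfSystems (hS : S ∈ halfSystems n) {r : ℝ}
    {u v w : EuclideanSpace ℝ (Fin 24)} (hu : u ∈ minimalVectors n) (hv : v ∈ minimalVectors n)
    (hw : w ∈ minimalVectors n) (huv : dist u v = r) (hvw : dist v w = r) (huw : dist u w = r) :
    ∃ x ∈ S, ∃ y ∈ S, dist x y = r := by
  have hmem : ∀ x ∈ minimalVectors n, x ∈ S ∨ -x ∈ S := fun x hx => (hS.2 x hx).or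
  rcases hmem u hu with hu | hu <;> rcases hmem v hv with hv | hv <;>
    rcases hmem w hw with hw | hw
  all_goals first
    | exact ⟨_, hu, _, hv, by simpa [dist_neg_neg] using huv⟩
    | exact ⟨_, hv, _, hw, by simpa [dist_neg_neg] using hvw⟩
    | exact ⟨_, hu, _, hw, by simpa [dist_neg_neg] using huw⟩

theorem placeVector_four_smul_mem_minimalVectors (hn : 1 ≤ n) (hu : Even (∑ i, u i))
    (hform : ∀ m : Fin 24, n ≤ m → conditionForm m ⬝ᵥ u = 0) (hsq : u ⬝ᵥ u = 2) :
    placeVector (4 • u) ∈ minimalVectors n := by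
  refine ⟨placeVector_four_smul_mem_laminatedLattice hn hu hform, ?_⟩
  rw [eq_comm, Real.sqrt_eq_iff_eq_sq (by norm_num) (norm_nonneg _), norm_placeVector_sq,
    smul_dotProduct, dotProduct_smul, hsq]
  norm_num

theorem dist_placeVector_four_smul (h : (t - u) ⬝ᵥ (t - u) = 6) :
    dist (placeVector (4 • t)) (placeVector (4 • u)) = √96 := by
  rw [eq_comm, Real.sqrt_eq_iff_eq_sq (by norm_num) dist_nonneg, dist_eq_norm, ← map_sub,
    norm_placeVector_sq, ← smul_sub, smul_dotProduct, dotProduct_smul, h]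
  norm_num

theorem exists_dist_eq_sqrt_of_mem_halfSystems (hn : 2 ≤ n) (hS : S ∈ halfSystems n) :
    ∃ v ∈ S, ∃ w ∈ S, dist v w = √96 := by
  -- `newVector 0`, `newVector 1` and minus their sum make angles of 120 degrees with each other.
  have hform : ∀ k : Fin 24, k < 2 → ∀ m : Fin 24, n ≤ m → conditionForm m ⬝ᵥ newVector k = 0 :=
    fun k hk m hm => conditionForm_dotProduct_newVector_of_lt k m (by omega)
  have hform0 := hform 0 (by decide)
  have hform1 := hform 1 (by decide)
  have hform2 : ∀ m : Fin 24, n ≤ m → conditionForm m ⬝ᵥ -(newVector 0 + newVector 1) = 0 :=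
    fun m hm => by rw [dotProduct_neg, dotProduct_add, hform0 m hm, hform1 m hm, add_zero, neg_zero]
  have hmem {t} := placeVector_four_smul_mem_minimalVectors (n := n) (u := t) (by omega)
  exact exists_dist_eq_of_mem_halfSystems hS
    (hmem (by decide) hform0 (by decide))
    (hmem (by decide) hform1 (by decide))
    (hmem (by decide) hform2 (by decide))
    (dist_placeVector_four_smul (by decide))
    (dist_placeVector_four_smul (by decide))
    (dist_placeVector_four_smul (by decide))

theorem diam_of_mem_halfSystems (hn : 2 ≤ n) (hn21 : n ≤ 21) (hS : S ∈ halfSystems n) :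
    Metric.diam S = √96 := by
  have hle : ∀ v ∈ S, ∀ w ∈ S, dist v w ≤ √96 := fun v hv w hw =>
    dist_le_of_mem_halfSystems (by omega) hn21 hS hv hw
  obtain ⟨v, hv, w, hw, hvw⟩ := exists_dist_eq_sqrt_of_mem_halfSystems hn hS
  exact le_antisymm (Metric.diam_le_of_forall_dist_le (Real.sqrt_nonneg _) hle)
    (hvw ▸ Metric.dist_le_diam_of_mem (Metric.isBounded_iff.2 ⟨_, hle⟩) hv hw)

theorem eq_or_eq_neg_of_norm_eq_of_finrank_le_one {E : Type*} [NormedAddCommGroup E]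
    [NormedSpace ℝ E] [FiniteDimensional ℝ E] (hE : Module.finrank ℝ E ≤ 1) {v w : E}
    (hvw : ‖v‖ = ‖w‖) : v = w ∨ v = -w := by
  obtain ⟨e, he⟩ := finrank_le_one_iff.1 hE
  obtain ⟨a, rfl⟩ := he v
  obtain ⟨b, rfl⟩ := he w
  rcases eq_or_ne e 0 with rfl | hne
  · simp
  · rw [norm_smul, norm_smul, mul_left_inj' (norm_ne_zero_iff.2 hne), Real.norm_eq_abs,
      Real.norm_eq_abs, abs_eq_abs] at hvw
    exact hvw.imp (congrArg (· • e)) fun h => by rw [h, neg_smul]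

theorem subsingleton_of_mem_halfSystems_one (hS : S ∈ halfSystems 1) : S.Subsingleton := by
  intro v hv w hw
  have hspan : ∀ x ∈ S, x ∈ Submodule.span ℝ (laminatedLattice 1) := fun x hx =>
    Submodule.subset_span (hS.1 hx).1
  rcases eq_or_eq_neg_of_norm_eq_of_finrank_le_one
      (finrank_span_laminatedLattice (n := 1) (by norm_num) (by norm_num)).le
      (v := ⟨v, hspan v hv⟩) (w := ⟨w, hspan w hw⟩)
      ((hS.1 hv).2.trans (hS.1 hw).2.symm) with h | h
  · exact congrArg Subtype.val h
  · obtain rfl : v = -w := congrArg Subtype.val h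
    exact absurd hv (neg_notMem_of_mem_halfSystems hS hw)

end MinimalVectors

/-- For `1 ≤ n ≤ 21` the laminated lattice `Λ_n` is `n`-dimensional, its set `M_n` of minimal vectors
can be divided into at most `n + 1` parts of diameter below `√96`, and so can every element of `H_n`;
these have diameter `√96` (for `n = 1` they are single points), so that none of them is a
counterexample to Borsuk's conjecture. -/
theorem mainTheorem1 (n : ℕ) (hn₁ : 1 ≤ n) (hn₂ : n ≤ 21) :
    Module.finrank ℝ (Submodule.span ℝ (laminatedLattice n)) = n ∧
    DivisibleInto (minimalVectors n) (n + 1) (√96) ∧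
    ∀ S ∈ halfSystems n,
      (2 ≤ n → Metric.diam S = √96) ∧
      DivisibleInto S (n + 1) (√96) ∧
      ¬ IsBorsukCounterexample n S := by
  have hdiv := divisibleInto_minimalVectors hn₁ hn₂
  refine ⟨finrank_span_laminatedLattice hn₁ (by omega), hdiv, fun S hS => ?_⟩
  have hdivS := hdiv.mono hS.1
  refine ⟨fun hn => diam_of_mem_halfSystems hn hn₂ hS, hdivS, ?_⟩
  rintro ⟨-, hnontrivial, -, hnotdiv⟩
  rcases hn₁.eq_or_lt with rfl | hn
  · exact Set.not_nontrivial_iff.2 (subsingleton_of_mem_halfSystems_one hS) hnontrivial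
  · exact hnotdiv (diam_of_mem_halfSystems hn hn₂ hS ▸ hdivS)
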